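/- **Setting.** Let $\Lambda\subset\mathbb R^d$ be compact. A *curve* in $\Lambda$ is a continuous map $f:[0,1]\to\Lambda$ up to reparametrization: $\mathcal S_\Lambda$ is the metric space obtained from the continuous maps $[0,1]\to\Lambda$ with $$\mathrm d(f_1,f_2)=\inf_{\phi_1,\phi_2}\ \sup_{t\in[0,1]}|f_1(\phi_1(t))-f_2(\phi_2(t))|$$ (infimum over continuous bijections $\phi_i$ of $[0,1]$ onto itself) by identifying maps at distance $0$. Let $\Omega_\Lambda$ be the space of closed subsets $\mathcal F$ of $\mathcal S_\Lambda$, with the topology of the Hausdorff distance and its Borel $\sigma$-algebra. A *system of random curves* in $\Lambda$ is a family $(\mu_\delta)_{0<\delta\le\delta_{\max}}$ of Borel probability measures on $\Omega_\Lambda$; $\mathcal F_\delta$ denotes the random configuration with law $\mu_\delta$. (In applications $\mathcal F_\delta$ consists of polygonal paths of step size $\delta$, but this is not required.) Probabilities of sets that are not measurable are understood as outer measures. A family of sets $A_1,\dots,A_k$ is *well separated* if the distance of each $A_j$ to the others is at least $\operatorname{diam}A_j$. A curve *traverses* a cylinder in the length direction if some segment of it stays in the (closed, solid) cylinder and joins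 its two end faces. The system satisfies **H2** if there are $\sigma>0$, $0\le\rho<1$ and $K<\infty$ such that, for every $\delta\in(0,\delta_{\max}]$, every $k$, and every well separated family of $k$ cylinders $A_1,\dots,A_k\subset\mathbb R^d$ of lengths $\ell_1,\dots,\ell_k\ge\delta$ and of cross-sectional diameters $\sigma\ell_1,\dots,\sigma\ell_k$, $$\mathrm{Prob}_\delta\big(\text{each }A_j\text{ is traversed in the length direction by a curve in }\mathcal F_\delta\big)\le K\rho^k .$$ For $s>0$, $\ell\ge0$ and $A\subset\mathbb R^d$, the capacity is defined by $$\frac1{\mathrm{Cap}_{s;\ell}(A)}=\inf_{\nu}\iint\frac{\nu(dx)\,\nu(dy)}{\max\{|x-y|,\ell\}^s},$$ the infimum being over the Borel probability measures $\nu$ on $\mathbb R^d$ that are supported on $A$. The diameter, capacity and Hausdorff dimension of a curve $\mathcal C$ are those of the set of points that it visits. A family of nonnegative (possibly infinite) random variables $X_\delta$ is *stochastically bounded away from zero* if for every $\varepsilon>0$ there is $u<\infty$ with $\mathrm{Prob}_\delta(X_\delta^{-1}\ge u)\le\varepsilon$ for all $\delta\in(0,\delta_{\max}]$. **Theorem (Roughness).**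 Let $(\mu_\delta)_{0<\delta\le\delta_{\max}}$ be a system of random curves in a compact set $\Lambda\subset\mathbb R^d$ that satisfies **H2**. Then there is $d_{\min}>1$ with the following properties. 1. For every $r>0$ and every $0<s<d_{\min}$, the random variable $$T_{s,r;\delta}=\inf_{\mathcal C\in\mathcal F_\delta:\ \operatorname{diam}\mathcal C\ge r}\mathrm{Cap}_{s;\delta}(\mathcal C)$$ (equal to $+\infty$ if there is no such curve) is stochastically bounded away from zero. 2. If $\delta_n\in(0,\delta_{\max}]$, $\delta_n\to0$, and $\mu_{\delta_n}$ converges weakly to a Borel probability measure $\mu$ on $\Omega_\Lambda$, then for $\mu$-almost every $\mathcal F$, every curve $\mathcal C\in\mathcal F$ that is not reduced to a point satisfies $\dim_{\mathcal H}\mathcal C\ge d_{\min}>1$; in particular it is not rectifiable. -/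

import Mathlib

open MeasureTheory Filter Topology TopologicalSpace
open scoped ENNReal NNReal

namespace RandomCurves

noncomputable section

/-- Euclidean space `ℝ^d`. -/
abbrev E (d : ℕ) : Type := EuclideanSpace ℝ (Fin d)

/-- The unit interval `[0, 1]`. -/
abbrev I : Type := unitInterval

/-! ### The space of curves -/

/-- Parametrized curves in `Λ`: continuous functions from the unit interval into `Λ`. -/
def ParamCurve {d : ℕ} (Λ : Set (E d)) : Type := C(I, Λ)

namespace ParamCurve

variable {d : ℕ} {Λ : Set (E d)}

/-- The position at time `t`, as a point of `ℝ^d`. -/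
def eval (f : ParamCurve Λ) (t : I) : E d := ((show C(I, Λ) from f) t : E d)

/-- Reparametrization by a continuous bijection of the unit interval onto itself.  Such
bijections are exactly the strictly monotone (increasing or decreasing) continuous ones. -/
def reparam (f : ParamCurve Λ) (φ : I ≃ₜ I) : C(I, Λ) :=
  (show C(I, Λ) from f).comp (φ : C(I, I))

/-- `d(f₁, f₂) = inf_{φ₁, φ₂} sup_t |f₁(φ₁(t)) - f₂(φ₂(t))|`, the infimum over all pairs of
reparametrizations (the distance in `C(I, Λ)` is the supremum distance). -/
def curveDist (f g : ParamCurve Λ) : ℝ :=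
  ⨅ p : (I ≃ₜ I) × (I ≃ₜ I), dist (f.reparam p.1) (g.reparam p.2)

theorem curveDist_bddBelow (f g : ParamCurve Λ) :
    BddBelow (Set.range fun p : (I ≃ₜ I) × (I ≃ₜ I) => dist (f.reparam p.1) (g.reparam p.2)) :=
  ⟨0, by rintro _ ⟨p, rfl⟩; exact dist_nonneg⟩

theorem curveDist_le (f g : ParamCurve Λ) (φ ψ : I ≃ₜ I) :
    curveDist f g ≤ dist (f.reparam φ) (g.reparam ψ) :=
  ciInf_le (curveDist_bddBelow f g) (φ, ψ)

theorem exists_reparam_lt {f g : ParamCurve Λ} {r : ℝ} (h : curveDist f g < r) :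
    ∃ φ ψ : I ≃ₜ I, dist (f.reparam φ) (g.reparam ψ) < r := by
  obtain ⟨p, hp⟩ := exists_lt_of_ciInf_lt h
  exact ⟨p.1, p.2, hp⟩

theorem dist_reparam_trans (f g : ParamCurve Λ) (φ ψ χ : I ≃ₜ I) :
    dist (f.reparam (χ.trans φ)) (g.reparam (χ.trans ψ)) ≤ dist (f.reparam φ) (g.reparam ψ) := by
  refine (ContinuousMap.dist_le dist_nonneg).2 fun t => ?_
  exact ContinuousMap.dist_apply_le_dist (f := f.reparam φ) (g := g.reparam ψ) (χ t)

theorem curveDist_triangle (f g h : ParamCurve Λ) :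
    curveDist f h ≤ curveDist f g + curveDist g h := by
  refine le_of_forall_pos_le_add fun ε hε => ?_
  obtain ⟨φ₁, φ₂, h₁⟩ := exists_reparam_lt (lt_add_of_pos_right (curveDist f g) (half_pos hε))
  obtain ⟨ψ₁, ψ₂, h₂⟩ := exists_reparam_lt (lt_add_of_pos_right (curveDist g h) (half_pos hε))
  have h₃ := dist_reparam_trans f g φ₁ φ₂ φ₂.symm
  have h₄ := dist_reparam_trans g h ψ₁ ψ₂ ψ₁.symm
  have e₁ : g.reparam (φ₂.symm.trans φ₂) = g.reparam (ψ₁.symm.trans ψ₁) := by simp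
  have h₅ := curveDist_le f h (φ₂.symm.trans φ₁) (ψ₁.symm.trans ψ₂)
  have h₆ := dist_triangle (f.reparam (φ₂.symm.trans φ₁)) (g.reparam (φ₂.symm.trans φ₂))
    (h.reparam (ψ₁.symm.trans ψ₂))
  rw [e₁] at h₃ h₆
  linarith

instance : PseudoMetricSpace (ParamCurve Λ) where
  dist := curveDist
  dist_self f := le_antisymm
    ((curveDist_le f f (Homeomorph.refl I) (Homeomorph.refl I)).trans (dist_self _).le)
    (Real.iInf_nonneg fun _ => dist_nonneg)
  dist_comm f g := by
    have key : ∀ f g : ParamCurve Λ, curveDist f g ≤ curveDist g f := fun f g =>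
      le_ciInf fun p => (curveDist_le f g p.2 p.1).trans (dist_comm _ _).le
    exact le_antisymm (key f g) (key g f)
  dist_triangle := curveDist_triangle

theorem dist_def (f g : ParamCurve Λ) : dist f g = curveDist f g := rfl

theorem continuous_eval (f : ParamCurve Λ) : Continuous f.eval :=
  continuous_subtype_val.comp (show C(I, Λ) from f).continuous

theorem range_eval_subset {f g : ParamCurve Λ} (h : dist f g = 0) :
    Set.range f.eval ⊆ Set.range g.eval := by
  rintro _ ⟨t, rfl⟩
  have hc : IsClosed (Set.range g.eval) := (isCompact_range g.continuous_eval).isClosed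
  rw [← hc.closure_eq, Metric.mem_closure_iff]
  intro ε hε
  obtain ⟨φ, ψ, hφ⟩ := exists_reparam_lt (show curveDist f g < ε from h.trans_lt hε)
  refine ⟨g.eval (ψ (φ.symm t)), ⟨_, rfl⟩, lt_of_le_of_lt ?_ hφ⟩
  have := ContinuousMap.dist_apply_le_dist (f := f.reparam φ) (g := g.reparam ψ) (φ.symm t)
  have e : g.reparam ψ (φ.symm t) = (show C(I, Λ) from g) (ψ (φ.symm t)) := rfl
  have e' : f.reparam φ (φ.symm t) = (show C(I, Λ) from f) t :=
    congrArg (show C(I, Λ) from f) (φ.apply_symm_apply t)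
  rwa [e, e'] at this

end ParamCurve

/-- The space `S_Λ` of curves in `Λ`: parametrized curves up to reparametrization, i.e. the metric
space obtained by identifying parametrized curves at distance zero. -/
abbrev Curve {d : ℕ} (Λ : Set (E d)) : Type := SeparationQuotient (ParamCurve Λ)

namespace Curve

variable {d : ℕ} {Λ : Set (E d)}

/-- `f` is a parametrization of the curve `C`. -/
def IsParam (C : Curve Λ) (f : ParamCurve Λ) : Prop := SeparationQuotient.mk f = C

/-- The set of points of `ℝ^d` visited by the curve. -/
def trace (C : Curve Λ) : Set (E d) := {x | ∃ f, C.IsParam f ∧ x ∈ Set.range f.eval}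

/-- The trace may be computed from any parametrization. -/
theorem trace_mk (f : ParamCurve Λ) :
    trace (SeparationQuotient.mk f : Curve Λ) = Set.range f.eval := by
  ext x
  constructor
  · rintro ⟨g, hg, hx⟩
    exact ParamCurve.range_eval_subset
      (Metric.inseparable_iff.1 (SeparationQuotient.mk_eq_mk.1 hg)) hx
  · exact fun hx => ⟨f, rfl, hx⟩

/-- The diameter of a curve. -/
def diam (C : Curve Λ) : ℝ := Metric.diam C.trace

/-- A curve is rectifiable if it has finite length. -/
def IsRectifiable (C : Curve Λ) : Prop := ∃ f, C.IsParam f ∧ eVariationOn f.eval Set.univ ≠ ∞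

end Curve

/-- The space `Ω_Λ` of configurations: closed sets of curves in `Λ`, with Mathlib's topology of
the Hausdorff (extended) distance. -/
abbrev Config {d : ℕ} (Λ : Set (E d)) : Type := Closeds (Curve Λ)

instance {d : ℕ} (Λ : Set (E d)) : MeasurableSpace (Config Λ) := borel _

instance {d : ℕ} (Λ : Set (E d)) : BorelSpace (Config Λ) := ⟨rfl⟩

/-! ### Cylinders and their crossings -/

/-- A (solid, round) cylinder in `ℝ^d`, given by the centers of its two end faces and
its radius. -/
structure Cylinder (d : ℕ) where
  base : E d
  top : E d
  radius : ℝ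
  base_ne_top : base ≠ top
  radius_pos : 0 < radius

namespace Cylinder

variable {d : ℕ}

def length (A : Cylinder d) : ℝ := dist A.base A.top

/-- The cross-sectional diameter. -/
def width (A : Cylinder d) : ℝ := 2 * A.radius

/-- The slice of the cylinder at relative height `t`: the closed `(d-1)`-dimensional ball
orthogonal to the axis. -/
def slice (A : Cylinder d) (t : ℝ) : Set (E d) :=
  {x | ∃ v : E d, inner ℝ v (A.top - A.base) = 0 ∧ ‖v‖ ≤ A.radius ∧
    x = A.base + t • (A.top - A.base) + v}

def carrier (A : Cylinder d) : Set (E d) := ⋃ t ∈ Set.Icc (0 : ℝ) 1, A.slice t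

end Cylinder

/-- A curve traverses a cylinder in the length direction if one of its segments stays in the
cylinder and joins its two end faces. -/
def Curve.Traverses {d : ℕ} {Λ : Set (E d)} (C : Curve Λ) (A : Cylinder d) : Prop :=
  ∃ f, C.IsParam f ∧ ∃ a b : I, a ≤ b ∧ f.eval a ∈ A.slice 0 ∧ f.eval b ∈ A.slice 1 ∧
    ∀ t ∈ Set.Icc a b, f.eval t ∈ A.carrier

/-- A family of sets is well separated if the distance of each set to the other ones is at least
as large as its diameter. -/
def WellSeparated {d : ℕ} {ι : Type*} (A : ι → Set (E d)) : Prop :=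
  ∀ i j, i ≠ j → ∀ x ∈ A i, ∀ y ∈ A j, Metric.ediam (A i) ≤ edist x y

/-- Hypothesis **H2**: a power bound on the probability of simultaneous crossings of well
separated cylinders of a fixed aspect ratio, uniform in the short-distance cutoff `δ`. -/
def HypothesisH2 {d : ℕ} {Λ : Set (E d)} {δmax : ℝ}
    (μ : Set.Ioc 0 δmax → ProbabilityMeasure (Config Λ)) : Prop :=
  ∃ σ ρ K : ℝ, 0 < σ ∧ 0 ≤ ρ ∧ ρ < 1 ∧
    ∀ (δ : Set.Ioc 0 δmax) (k : ℕ) (A : Fin k → Cylinder d),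
      WellSeparated (fun j => (A j).carrier) →
      (∀ j, (A j).width = σ * (A j).length) →
      (∀ j, (δ : ℝ) ≤ (A j).length) →
      (μ δ : Measure (Config Λ)).real {F | ∀ j, ∃ C ∈ F, C.Traverses (A j)} ≤ K * ρ ^ k

/-! ### Capacity -/

/-- The energy `∬ max(|x-y|, ℓ)^{-s} ν(dx) ν(dy)`, with values in `[0, ∞]`. -/
def energy {d : ℕ} (s ℓ : ℝ) (ν : ProbabilityMeasure (E d)) : ℝ≥0∞ :=
  ∫⁻ x, ∫⁻ y, (max (edist x y) (ENNReal.ofReal ℓ)) ^ (-s) ∂(ν : Measure (E d))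
    ∂(ν : Measure (E d))

/-- The capacity `Cap_{s;ℓ}(A)`: its inverse is the infimum of the energy over the probability
measures supported on `A`. -/
def capacity {d : ℕ} (s ℓ : ℝ) (A : Set (E d)) : ℝ≥0∞ :=
  (⨅ (ν : ProbabilityMeasure (E d)) (_ : (ν : Measure (E d)) Aᶜ = 0), energy s ℓ ν)⁻¹

/-- `T_{s,r;δ}`: the infimum of the capacities `Cap_{s;δ}(C)` over the curves of the configuration
with diameter at least `r` (equal to `∞` if there is no such curve). -/
def minCapacity {d : ℕ} {Λ : Set (E d)} (s r δ : ℝ) (F : Config Λ) : ℝ≥0∞ :=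
  ⨅ (C : Curve Λ) (_ : C ∈ F) (_ : r ≤ C.diam), capacity s δ C.trace

/-! ### Stochastic boundedness -/

/-- A family of `[0, ∞]`-valued functions `X_δ` is stochastically bounded as `δ → 0`. -/
def StochasticallyBounded {Ω : Type*} [MeasurableSpace Ω] {δmax : ℝ}
    (μ : Set.Ioc 0 δmax → ProbabilityMeasure Ω) (X : Set.Ioc 0 δmax → Ω → ℝ≥0∞) : Prop :=
  ∀ ε : ℝ, 0 < ε → ∃ u : ℝ≥0, ∀ δ : Set.Ioc 0 δmax,
    (μ δ : Measure Ω).real {ω | (u : ℝ≥0∞) ≤ X δ ω} ≤ ε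

/-- Stochastically bounded away from zero: the inverse is stochastically bounded. -/
def StochasticallyBoundedAwayFromZero {Ω : Type*} [MeasurableSpace Ω] {δmax : ℝ}
    (μ : Set.Ioc 0 δmax → ProbabilityMeasure Ω) (X : Set.Ioc 0 δmax → Ω → ℝ≥0∞) : Prop :=
  StochasticallyBounded μ (fun δ ω => (X δ ω)⁻¹)

end

end RandomCurves

open RandomCurves

/-!
Starting from each point of a loop erasure with steps a little longer than `ℓ`, a curve makes an
excursion of length `ℓ`, and these excursions are well separated. In this way a segment of a curve
whose end points are at distance slightly more than `q ^ 4 * ℓ` contains `q ^ 4` well separated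
segments of length `ℓ`. Either the loop erasure has `q ^ 4 + q ^ 2` steps, or it stays close to the
line through the end points; in the second case further segments are found far from this line,
unless the whole segment is *straight*, that is, close to the line. If on every branch of the
resulting tree of segments at most half of the levels are straight, then the uniform measure on its
leaves has bounded energy for all exponents below some `D > 1`.

A straight segment crosses many thin and well separated cylinders. Since the scales shrink
geometrically, the cylinders of different levels are well separated as well, so **H2**, together
with a union bound over a net of chains of segments, makes many straight levels exponentially
unlikely.

The capacity is upper semicontinuous in the curve, so the energy bounds survive the weak limit, and
a bound on the energies that is uniform in the cutoff forces a positive Hausdorff measure. A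
rectifiable curve, in contrast, has dimension at most one.
-/

namespace RandomCurves

noncomputable section

/-! ### Crossings of levels by continuous functions -/

section Crossing

variable {α β : Type*} [ConditionallyCompleteLinearOrder α] [TopologicalSpace α] [OrderTopology α]
  [DenselyOrdered α] [LinearOrder β] [TopologicalSpace β] [OrderClosedTopology β]
  {g : α → β} {a b : α} {y z : β}

theorem exists_first_hit (hg : ContinuousOn g (Set.Icc a b)) (hab : a ≤ b) (ha : g a ≤ y)
    (hb : y ≤ g b) : ∃ u ∈ Set.Icc a b, g u = y ∧ ∀ t ∈ Set.Icc a u, g t ≤ y := by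
  have hits_compact : IsCompact (Set.Icc a b ∩ g ⁻¹' {y}) :=
    isCompact_Icc.of_isClosed_subset
      (hg.preimage_isClosed_of_isClosed isClosed_Icc isClosed_singleton) Set.inter_subset_left
  have hits_nonempty : (Set.Icc a b ∩ g ⁻¹' {y}).Nonempty :=
    intermediate_value_Icc hab hg ⟨ha, hb⟩
  obtain ⟨u, ⟨hu, huy⟩, u_le⟩ := hits_compact.exists_isLeast hits_nonempty
  refine ⟨u, hu, huy, fun t ht => ?_⟩
  by_contra! hlt
  have htb : t ≤ b := ht.2.trans hu.2
  obtain ⟨v, hv, hvy⟩ := intermediate_value_Icc ht.1 (hg.mono (Set.Icc_subset_Icc_right htb))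
    ⟨ha, hlt.le⟩
  have huv : u ≤ v := u_le ⟨⟨hv.1, hv.2.trans htb⟩, hvy⟩
  obtain rfl : t = v := le_antisymm (ht.2.trans huv) hv.2
  exact hlt.ne' hvy

theorem exists_last_hit (hg : ContinuousOn g (Set.Icc a b)) (hab : a ≤ b) (ha : g a ≤ y)
    (hb : y ≤ g b) : ∃ u ∈ Set.Icc a b, g u = y ∧ ∀ t ∈ Set.Icc u b, y ≤ g t := by
  have Icc_dual : Set.Icc (α := αᵒᵈ) b a = Set.Icc (α := α) a b := Set.Icc_toDual
  obtain ⟨u, hu, huy, h⟩ := exists_first_hit (α := αᵒᵈ) (β := βᵒᵈ) (g := g) (a := b) (b := a)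
    (y := y) (by rwa [Icc_dual]) hab hb ha
  exact ⟨u, ⟨hu.2, hu.1⟩, huy, fun t ht => h t ⟨ht.2, ht.1⟩⟩

theorem exists_crossing (hg : ContinuousOn g (Set.Icc a b)) (hab : a ≤ b) (ha : g a ≤ y)
    (hyz : y ≤ z) (hb : z ≤ g b) :
    ∃ s u, a ≤ s ∧ s ≤ u ∧ u ≤ b ∧ g s = y ∧ g u = z ∧ ∀ t ∈ Set.Icc s u, g t ∈ Set.Icc y z := by
  obtain ⟨u, hu, huz, le_z⟩ := exists_first_hit hg hab (ha.trans hyz) hb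
  obtain ⟨s, hs, hsy, y_le⟩ := exists_last_hit (hg.mono (Set.Icc_subset_Icc_right hu.2)) hu.1 ha
    (hyz.trans huz.ge)
  exact ⟨s, u, hs.1, hs.2, hu.2, hsy, huz,
    fun t ht => ⟨y_le t ht, le_z t ⟨hs.1.trans ht.1, ht.2⟩⟩⟩

end Crossing

/-! ### Separated families of segments of a path -/

section Segments

variable {X : Type*} [PseudoMetricSpace X] {F : ℝ → X} {a b L : ℝ}

/-- The restriction of the path `F` to `[a, b]` is a segment of size `L`: it joins two points at
distance `L` and stays within distance `L` of its starting point. -/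
structure IsSegment (F : ℝ → X) (L a b : ℝ) : Prop where
  le : a ≤ b
  dist_eq : dist (F a) (F b) = L
  dist_le : ∀ t ∈ Set.Icc a b, dist (F a) (F t) ≤ L

theorem exists_isSegment (hF : Continuous F) (hab : a ≤ b) (hL : 0 ≤ L)
    (h : L ≤ dist (F a) (F b)) : ∃ v ∈ Set.Icc a b, IsSegment F L a v := by
  obtain ⟨v, hv, hdist, dist_le⟩ := exists_first_hit (g := fun t => dist (F a) (F t))
    (by fun_prop) hab ((dist_self _).trans_le hL) h
  exact ⟨v, hv, hv.1, hdist, dist_le⟩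

/-- The segments of size `L` of the path `F` over the intervals `[u i, v i] ⊆ [a, b]` are at mutual
distance at least `κ`. -/
structure SeparatedSegments {ι : Type*} (F : ℝ → X) (a b L κ : ℝ) (u v : ι → ℝ) : Prop where
  left_le : ∀ i, a ≤ u i
  le_right : ∀ i, v i ≤ b
  isSegment : ∀ i, IsSegment F L (u i) (v i)
  le_dist : Pairwise fun i j =>
    ∀ s ∈ Set.Icc (u i) (v i), ∀ t ∈ Set.Icc (u j) (v j), κ ≤ dist (F s) (F t)

namespace SeparatedSegments

variable {ι ι' : Type*} {κ : ℝ} {u v : ι → ℝ} {u' v' : ι' → ℝ}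

theorem comp (h : SeparatedSegments F a b L κ u v) (e : ι' ↪ ι) :
    SeparatedSegments F a b L κ (u ∘ e) (v ∘ e) where
  left_le i := h.left_le (e i)
  le_right i := h.le_right (e i)
  isSegment i := h.isSegment (e i)
  le_dist _ _ hij := h.le_dist (e.injective.ne hij)

theorem mono_right (h : SeparatedSegments F a b L κ u v) {c : ℝ} (hbc : b ≤ c) :
    SeparatedSegments F a c L κ u v :=
  { h with le_right := fun i => (h.le_right i).trans hbc }

theorem sumElim (h : SeparatedSegments F a b L κ u v) (h' : SeparatedSegments F a b L κ u' v')
    (hd : ∀ i j, ∀ s ∈ Set.Icc (u i) (v i), ∀ t ∈ Set.Icc (u' j) (v' j), κ ≤ dist (F s) (F t)) :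
    SeparatedSegments F a b L κ (Sum.elim u u') (Sum.elim v v') where
  left_le := Sum.rec h.left_le h'.left_le
  le_right := Sum.rec h.le_right h'.le_right
  isSegment := Sum.rec h.isSegment h'.isSegment
  le_dist := by
    rintro (i | i) (j | j) hij s hs t ht
    · exact h.le_dist (ne_of_apply_ne _ hij) s hs t ht
    · exact hd i j s hs t ht
    · rw [dist_comm]
      exact hd j i t ht s hs
    · exact h'.le_dist (ne_of_apply_ne _ hij) s hs t ht

theorem of_lt [LinearOrder ι] (left_le : ∀ i, a ≤ u i) (le_right : ∀ i, v i ≤ b)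
    (isSegment : ∀ i, IsSegment F L (u i) (v i))
    (le_dist : ∀ i j, i < j → ∀ s ∈ Set.Icc (u i) (v i), ∀ t ∈ Set.Icc (u j) (v j),
      κ ≤ dist (F s) (F t)) : SeparatedSegments F a b L κ u v where
  left_le := left_le
  le_right := le_right
  isSegment := isSegment
  le_dist := by
    intro i j hij s hs t ht
    rcases hij.lt_or_gt with hlt | hgt
    · exact le_dist i j hlt s hs t ht
    · rw [dist_comm]
      exact le_dist j i hgt t ht s hs

end SeparatedSegments

/-- Times of a loop erasure of the path `F` over `[a, b]` with step `η`. As long as `F b` is at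
distance at least `η` from the current point, the next point is the last one at distance `η` from
it, so that the path never returns to the `η`-ball of a previous point; later times are
unconstrained. -/
structure IsLoopErasure (F : ℝ → X) (η a b : ℝ) (t : ℕ → ℝ) : Prop where
  zero : t 0 = a
  monotone : Monotone t
  le_right : ∀ i, t i ≤ b
  dist_succ : ∀ i, η ≤ dist (F (t i)) (F b) → dist (F (t i)) (F (t (i + 1))) = η
  le_dist : ∀ i, η ≤ dist (F (t i)) (F b) → ∀ s ∈ Set.Icc (t (i + 1)) b, η ≤ dist (F (t i)) (F s)

theorem exists_isLoopErasure (hF : Continuous F) (hab : a ≤ b) {η : ℝ} (hη : 0 ≤ η) :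
    ∃ t : ℕ → ℝ, IsLoopErasure F η a b t := by
  have exists_next : ∀ x : Set.Iic b, ∃ y : Set.Iic b, x ≤ y ∧ (η ≤ dist (F x) (F b) →
      dist (F x) (F y) = η ∧ ∀ s ∈ Set.Icc (y : ℝ) b, η ≤ dist (F x) (F s)) := by
    intro x
    by_cases hx : η ≤ dist (F x) (F b)
    · obtain ⟨y, hy, hdist, le_dist⟩ := exists_last_hit (g := fun s => dist (F x) (F s))
        (by fun_prop) x.2 ((dist_self _).trans_le hη) hx
      exact ⟨⟨y, hy.2⟩, hy.1, fun _ => ⟨hdist, le_dist⟩⟩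
    · exact ⟨x, le_rfl, fun h => absurd h hx⟩
  choose next le_next next_spec using exists_next
  let t : ℕ → Set.Iic b := fun i => next^[i] ⟨a, hab⟩
  have t_succ : ∀ i, t (i + 1) = next (t i) := fun i => Function.iterate_succ_apply' ..
  refine ⟨fun i => t i, rfl, monotone_nat_of_le_succ fun i => ?_, fun i => (t i).2,
    fun i hi => ?_, fun i hi => ?_⟩
  all_goals simp only [t_succ]
  exacts [le_next _, (next_spec _ hi).1, (next_spec _ hi).2]

namespace IsLoopErasure

variable {η : ℝ} {t : ℕ → ℝ} {n : ℕ}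

theorem dist_le (h : IsLoopErasure F η a b t) (hn : ∀ i < n, η ≤ dist (F (t i)) (F b)) {i j : ℕ}
    (hij : i ≤ j) (hj : j ≤ n) : dist (F (t i)) (F (t j)) ≤ (j - i : ℕ) * η := by
  refine (dist_le_Ico_sum_of_dist_le (f := fun k => F (t k)) (d := fun _ => η) hij
    fun {k} _ hk => (h.dist_succ k (hn k (hk.trans_le hj))).le).trans_eq ?_
  rw [Finset.sum_const, Nat.card_Ico, nsmul_eq_mul]

theorem le_dist_of_mul_le (h : IsLoopErasure F η a b t) (hab : n * η ≤ dist (F a) (F b))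
    (hη : 0 ≤ η) : ∀ i < n, η ≤ dist (F (t i)) (F b) := by
  intro i
  induction i using Nat.strong_induction_on with
  | _ i ih =>
    intro hi
    have traveled := h.dist_le (fun j hj => ih j hj (hj.trans hi)) i.zero_le le_rfl
    rw [h.zero, Nat.sub_zero] at traveled
    have hin : ((i : ℝ) + 1) * η ≤ n * η := by
      gcongr
      exact_mod_cast hi
    linarith [dist_triangle (F a) (F (t i)) (F b)]

theorem dist_add_dist_le (h : IsLoopErasure F η a b t)
    (hn : ∀ i < n, η ≤ dist (F (t i)) (F b)) (hlast : dist (F (t n)) (F b) ≤ η) {i : ℕ}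
    (hi : i ≤ n) : dist (F a) (F (t i)) + dist (F (t i)) (F b) ≤ (n + 1) * η := by
  have before := h.dist_le hn i.zero_le hi
  have after := h.dist_le hn hi le_rfl
  rw [h.zero, Nat.sub_zero] at before
  rw [Nat.cast_sub hi] at after
  linarith [dist_triangle (F (t i)) (F (t n)) (F b)]

theorem exists_separatedSegments (h : IsLoopErasure F η a b t) (hF : Continuous F) (hL : 0 ≤ L)
    (hLη : L ≤ η) (hn : ∀ i < n, η ≤ dist (F (t i)) (F b)) :
    ∃ v : Fin n → ℝ, SeparatedSegments F a b L (η - L) (fun i : Fin n => t i) v := by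
  have exists_end (i : Fin n) : ∃ v ∈ Set.Icc (t i) (t (i + 1)), IsSegment F L (t i) v :=
    exists_isSegment hF (h.monotone i.1.le_succ) hL
      (hLη.trans (h.dist_succ i (hn i i.2)).ge)
  choose v v_mem isSegment using exists_end
  refine ⟨v, .of_lt (fun i => h.zero ▸ h.monotone i.1.zero_le)
    (fun i => (v_mem i).2.trans (h.le_right _)) isSegment fun i j hij s hs x hx => ?_⟩
  have later : x ∈ Set.Icc (t (i + 1)) b :=
    ⟨(h.monotone hij).trans hx.1, hx.2.trans ((v_mem j).2.trans (h.le_right _))⟩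
  have far := h.le_dist i (hn i i.2) x later
  have near := (isSegment i).dist_le s hs
  linarith [dist_triangle (F (t i)) (F s) (F x)]

end IsLoopErasure

/-- The segments cross the slabs `[c + i η, c + i η + L]` of the function `f`. -/
theorem exists_separatedSegments_of_lipschitzWith (hF : Continuous F) {f : X → ℝ}
    (hf : LipschitzWith 1 f) {c η : ℝ} (hab : a ≤ b) (hL : 0 ≤ L) (hLη : L ≤ η) {n : ℕ}
    (ha : f (F a) ≤ c) (hb : c + n * η ≤ f (F b)) :
    ∃ u v : Fin n → ℝ, SeparatedSegments F a b L (η - L) u v ∧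
      ∀ i, ∀ s ∈ Set.Icc (u i) (v i), c ≤ f (F s) := by
  have hη : 0 ≤ η := hL.trans hLη
  have le_dist (x y : X) : f y - f x ≤ dist x y :=
    sub_le_iff_le_add'.2 (by simpa [dist_comm] using hf.le_add_mul y x)
  have exists_slab_crossing (i : Fin n) : ∃ u v, a ≤ u ∧ v ≤ b ∧ IsSegment F L u v ∧
      ∀ s ∈ Set.Icc u v, f (F s) ∈ Set.Icc (c + i * η) (c + i * η + L) := by
    have hi : ((i : ℕ) + 1) * η ≤ n * η := by
      gcongr
      exact_mod_cast i.2
    have hi0 : 0 ≤ (i : ℕ) * η := by positivity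
    obtain ⟨s, u, has, hsu, hub, hs, hu, hmem⟩ := exists_crossing (g := fun t => f (F t))
      (hf.continuous.comp hF).continuousOn hab (y := c + i * η) (z := c + i * η + L)
      (by linarith) (by linarith) (by linarith)
    obtain ⟨v, hv, hseg⟩ := exists_isSegment hF hsu hL (by linarith [le_dist (F s) (F u)])
    exact ⟨s, v, has, hv.2.trans hub, hseg, fun x hx => hmem x ⟨hx.1, hx.2.trans hv.2⟩⟩
  choose u v left_le le_right isSegment mem_slab using exists_slab_crossing
  refine ⟨u, v, .of_lt left_le le_right isSegment fun i j hij s hs x hx => ?_, fun i s hs => ?_⟩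
  · have hij' : ((i : ℕ) + 1) * η ≤ (j : ℕ) * η := by
      gcongr
      exact_mod_cast hij
    linarith [(mem_slab i s hs).2, (mem_slab j x hx).1, le_dist (F s) (F x)]
  · have hi0 : 0 ≤ (i : ℕ) * η := by positivity
    linarith [(mem_slab i s hs).1]

end Segments

/-! ### Straight segments and the number of children of a segment -/

section Straight

variable {V : Type*} [NormedAddCommGroup V] [InnerProductSpace ℝ V]

/-- The distance of `z` to the line through `x` with direction `v`. -/
def lineDist (x v z : V) : ℝ := ‖(ℝ ∙ v)ᗮ.starProjection (z - x)‖

theorem lineDist_self (x v : V) : lineDist x v x = 0 := by simp [lineDist]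

theorem lineDist_nonneg (x v z : V) : 0 ≤ lineDist x v z := norm_nonneg _

theorem lineDist_le_add_dist (x v z z' : V) : lineDist x v z ≤ lineDist x v z' + dist z z' := by
  have h : z - x = (z' - x) + (z - z') := by abel
  rw [lineDist, h, map_add, dist_eq_norm]
  exact (norm_add_le _ _).trans
    (add_le_add_right (Submodule.norm_starProjection_apply_le _ _) _)

theorem lipschitzWith_lineDist (x v : V) : LipschitzWith 1 (lineDist x v) :=
  .of_le_add (lineDist_le_add_dist x v)

theorem norm_sq_eq_inner_sq_add_lineDist_sq {v : V} (hv : ‖v‖ = 1) (x z : V) :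
    ‖z - x‖ ^ 2 = inner ℝ v (z - x) ^ 2 + lineDist x v z ^ 2 := by
  rw [Submodule.norm_sq_eq_add_norm_sq_starProjection (z - x) (ℝ ∙ v),
    Submodule.starProjection_unit_singleton ℝ hv, norm_smul, hv, mul_one, Real.norm_eq_abs, sq_abs,
    lineDist]

/-- Reflecting the second half of the broken line `x, z, y` in the direction `y - x` makes its end
points differ by `y - x + 2 w`, where `w` is the orthogonal vector from the line to `z`. -/
theorem dist_sq_add_four_mul_lineDist_sq_le (x y z : V) :
    dist x y ^ 2 + 4 * lineDist x (y - x) z ^ 2 ≤ (dist x z + dist z y) ^ 2 := by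
  set w := (ℝ ∙ (y - x))ᗮ.starProjection (z - x) with hw
  have reflected : (z - x) + (ℝ ∙ (y - x)).reflection (y - z) = (y - x) + (2 : ℝ) • w := by
    have proj_self : (ℝ ∙ (y - x)).starProjection (y - x) = y - x :=
      Submodule.starProjection_eq_self_iff.2 (Submodule.mem_span_singleton_self _)
    rw [show y - z = (y - x) - (z - x) by abel, Submodule.reflection_apply, map_sub, proj_self, hw,
      Submodule.starProjection_orthogonal_val]
    module
  have orthogonal : inner ℝ (y - x) ((2 : ℝ) • w) = 0 := by
    rw [inner_smul_right, Submodule.mem_orthogonal_singleton_iff_inner_right.1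
      (Submodule.starProjection_apply_mem _ _), mul_zero]
  calc dist x y ^ 2 + 4 * lineDist x (y - x) z ^ 2 = ‖(y - x) + (2 : ℝ) • w‖ ^ 2 := by
        rw [sq ‖_ + _‖, norm_add_sq_eq_norm_sq_add_norm_sq_of_inner_eq_zero _ _ orthogonal,
          norm_smul, dist_eq_norm', lineDist, Real.norm_ofNat]
        ring
    _ = ‖(z - x) + (ℝ ∙ (y - x)).reflection (y - z)‖ ^ 2 := by rw [reflected]
    _ ≤ (dist x z + dist z y) ^ 2 := by
        rw [dist_eq_norm' x z, dist_eq_norm' z y]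
        gcongr
        exact (norm_add_le _ _).trans_eq (by rw [LinearIsometryEquiv.norm_map])

/-- The path stays over `[a, b]` within distance `w` of the line through its end points. -/
def IsStraight (F : ℝ → V) (w a b : ℝ) : Prop :=
  ∀ t ∈ Set.Icc a b, lineDist (F a) (F b - F a) (F t) ≤ w

variable {F : ℝ → V} {a b L : ℝ} {q : ℕ}

open Classical in
/-- The number of well separated segments, smaller by the factor `q ^ 4 + q`, that are used inside
the segment of `F` over `[a, b]`: `q ^ 2` more if the segment is not straight. -/
def branching (F : ℝ → V) (q : ℕ) (a b : ℝ) : ℕ :=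
  if IsStraight F (2 * dist (F a) (F b) / q) a b then q ^ 4 else q ^ 4 + q ^ 2

theorem branching_pos (hq : 0 < q) : 0 < branching F q a b := by
  unfold branching
  split_ifs <;> positivity

/-- The thin neighbourhood of the line that contains a loop erasure with fewer than `q ^ 4 + q ^ 2`
steps is avoided by the part of the path near a point at distance `2 L / q` from the line, which
crosses `q ^ 3 - 1` further slabs. -/
theorem IsLoopErasure.exists_separatedSegments_of_not_isStraight {η ℓ : ℝ} {t : ℕ → ℝ} {n : ℕ}
    (h : IsLoopErasure F η a b t) (hF : Continuous F) (hℓ : 0 ≤ ℓ) (hℓη : ℓ ≤ η) (hq : 1 ≤ q)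
    (hab : dist (F a) (F b) = q ^ 4 * η) (hn : ∀ i < n, η ≤ dist (F (t i)) (F b))
    (hlast : dist (F (t n)) (F b) ≤ η) (hnq : n < q ^ 4 + q ^ 2)
    (hstraight : ¬ IsStraight F (2 * dist (F a) (F b) / q) a b) :
    ∃ u v : Fin n ⊕ Fin (q ^ 3 - 1) → ℝ, SeparatedSegments F a b ℓ (η - ℓ) u v := by
  have hη : 0 ≤ η := hℓ.trans hℓη
  have hq1 : (1 : ℝ) ≤ q := by exact_mod_cast hq
  set f := lineDist (F a) (F b - F a)
  have near_line : ∀ i ≤ n, f (F (t i)) ≤ q ^ 3 * η := by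
    intro i hi
    have ellipse : (q ^ 4 * η) ^ 2 + 4 * f (F (t i)) ^ 2 ≤ _ :=
      hab ▸ dist_sq_add_four_mul_lineDist_sq_le (F a) (F b) (F (t i))
    have hsum : dist (F a) (F (t i)) + dist (F (t i)) (F b) ≤ (q ^ 4 + q ^ 2) * η :=
      (h.dist_add_dist_le hn hlast hi).trans (by gcongr ?_ * η; exact_mod_cast hnq)
    have hsq : (dist (F a) (F (t i)) + dist (F (t i)) (F b)) ^ 2 ≤ ((q ^ 4 + q ^ 2) * η) ^ 2 := by
      gcongr
    have hpow : (q : ℝ) ^ 4 * η ^ 2 ≤ q ^ 6 * η ^ 2 := by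
      gcongr
      norm_num
    refine le_of_sq_le_sq (?_ : f (F (t i)) ^ 2 ≤ (q ^ 3 * η) ^ 2) (by positivity)
    linarith [sq_nonneg (q ^ 3 * η)]
  obtain ⟨T, hT, hfar⟩ : ∃ T ∈ Set.Icc a b, 2 * dist (F a) (F b) / q < f (F T) := by
    simpa only [IsStraight, not_forall, not_le, exists_prop] using hstraight
  have two_mul_pow : 2 * dist (F a) (F b) / q = 2 * q ^ 3 * η := by
    rw [hab]
    field_simp
  obtain ⟨v, hv⟩ := h.exists_separatedSegments hF hℓ hℓη hn
  obtain ⟨u', v', hs', far_line⟩ := exists_separatedSegments_of_lipschitzWith hF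
    (lipschitzWith_lineDist (F a) (F b - F a)) (c := q ^ 3 * η + η) (n := q ^ 3 - 1) hT.1 hℓ hℓη
    (by rw [lineDist_self]; positivity) (by
      rw [Nat.cast_sub (Nat.one_le_pow _ _ hq)]
      push_cast
      linarith)
  refine ⟨_, _, hv.sumElim (hs'.mono_right hT.2) fun i j s hs x hx => ?_⟩
  linarith [near_line i i.2.le, (hv.isSegment i).dist_le s hs, far_line j x hx,
    lineDist_le_add_dist (F a) (F b - F a) (F x) (F s), dist_comm (F s) (F x),
    lineDist_le_add_dist (F a) (F b - F a) (F s) (F (t i)), dist_comm (F (t i)) (F s)]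

theorem exists_separatedSegments_branching (hF : Continuous F) (hq : 2 ≤ q) (hab : a ≤ b) {η ℓ : ℝ}
    (hℓ : 0 ≤ ℓ) (hℓη : ℓ ≤ η) (hd : dist (F a) (F b) = q ^ 4 * η) :
    ∃ u v : Fin (branching F q a b) → ℝ, SeparatedSegments F a b ℓ (η - ℓ) u v := by
  obtain ⟨t, ht⟩ := exists_isLoopErasure hF hab (hℓ.trans hℓη)
  have long : ∀ i < q ^ 4, η ≤ dist (F (t i)) (F b) :=
    ht.le_dist_of_mul_le (by simp [hd]) (hℓ.trans hℓη)
  by_cases hstraight : IsStraight F (2 * dist (F a) (F b) / q) a b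
  · rw [branching, if_pos hstraight]
    exact ⟨_, ht.exists_separatedSegments hF hℓ hℓη long⟩
  rw [branching, if_neg hstraight]
  by_cases hlong : ∀ i < q ^ 4 + q ^ 2, η ≤ dist (F (t i)) (F b)
  · exact ⟨_, ht.exists_separatedSegments hF hℓ hℓη hlong⟩
  obtain ⟨n, ⟨hnq, hlast⟩, hmin⟩ : ∃ n, (n < q ^ 4 + q ^ 2 ∧ dist (F (t n)) (F b) < η) ∧
      ∀ i < n, ¬ (i < q ^ 4 + q ^ 2 ∧ dist (F (t i)) (F b) < η) := by
    push Not at hlong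
    classical exact ⟨_, Nat.find_spec hlong, fun i => Nat.find_min hlong⟩
  have hn : ∀ i < n, η ≤ dist (F (t i)) (F b) := fun i hi =>
    not_lt.1 fun hlt => hmin i hi ⟨hi.trans hnq, hlt⟩
  have le_n : q ^ 4 ≤ n := not_lt.1 fun hlt => hlast.not_ge (long n hlt)
  obtain ⟨u, v, huv⟩ := ht.exists_separatedSegments_of_not_isStraight hF hℓ hℓη (by omega) hd hn
    hlast.le hnq hstraight
  have hcard : Fintype.card (Fin (q ^ 4 + q ^ 2)) ≤ Fintype.card (Fin n ⊕ Fin (q ^ 3 - 1)) := by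
    have : q ^ 2 + 1 ≤ q ^ 3 := by nlinarith [Nat.pow_le_pow_left hq 2]
    simp only [Fintype.card_sum, Fintype.card_fin]
    omega
  obtain ⟨e⟩ := Function.Embedding.nonempty_of_card_le hcard
  exact ⟨u ∘ e, v ∘ e, huv.comp e⟩

end Straight

/-! ### Energies of mixtures -/

section Energy

theorem rpow_neg_le_rpow_neg {x y : ℝ≥0∞} {s : ℝ} (hs : 0 ≤ s) (h : x ≤ y) :
    y ^ (-s) ≤ x ^ (-s) := by
  rw [ENNReal.rpow_neg, ENNReal.rpow_neg]
  exact ENNReal.inv_le_inv.2 (ENNReal.rpow_le_rpow h hs)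

/-- The mixture, with equal weights, of finitely many probability measures. -/
def uniformMixture {ι Ω : Type*} [Fintype ι] [Nonempty ι] [MeasurableSpace Ω]
    (ν : ι → ProbabilityMeasure Ω) : ProbabilityMeasure Ω :=
  ⟨(Fintype.card ι : ℝ≥0∞)⁻¹ • ∑ i, (ν i : Measure Ω), ⟨by
    simp [ENNReal.inv_mul_cancel (Nat.cast_ne_zero.2 (Fintype.card_ne_zero (α := ι)))
      (ENNReal.natCast_ne_top _)]⟩⟩

theorem uniformMixture_eq_zero {ι Ω : Type*} [Fintype ι] [Nonempty ι] [MeasurableSpace Ω]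
    {ν : ι → ProbabilityMeasure Ω} {A : Set Ω} (h : ∀ i, (ν i : Measure Ω) A = 0) :
    (uniformMixture ν : Measure Ω) A = 0 := by
  change ((Fintype.card ι : ℝ≥0∞)⁻¹ • ∑ i, (ν i : Measure Ω)) A = 0
  simp only [Measure.smul_apply, Measure.finsetSum_apply, h, Finset.sum_const_zero, smul_zero]

variable {d : ℕ} {s ℓ : ℝ}

/-- The mutual energy `∬ max(|x-y|, ℓ)^{-s} μ(dx) ν(dy)` of two measures. -/
def mutualEnergy (s ℓ : ℝ) (μ ν : Measure (E d)) : ℝ≥0∞ :=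
  ∫⁻ x, ∫⁻ y, (max (edist x y) (ENNReal.ofReal ℓ)) ^ (-s) ∂ν ∂μ

theorem measurable_energyKernel (s ℓ : ℝ) :
    Measurable fun p : E d × E d => (max (edist p.1 p.2) (ENNReal.ofReal ℓ)) ^ (-s) :=
  (measurable_edist.max measurable_const).pow_const _

theorem energy_dirac (s ℓ : ℝ) (x : E d) :
    energy s ℓ ⟨Measure.dirac x, inferInstance⟩ = ENNReal.ofReal ℓ ^ (-s) := by
  simp [energy]

theorem mutualEnergy_le_of_le_dist (hs : 0 ≤ s) {κ : ℝ} {μ ν : Measure (E d)}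
    [IsProbabilityMeasure μ] [IsProbabilityMeasure ν] {S T : Set (E d)} (hμ : μ Sᶜ = 0)
    (hν : ν Tᶜ = 0) (hST : ∀ x ∈ S, ∀ y ∈ T, κ ≤ dist x y) :
    mutualEnergy s ℓ μ ν ≤ ENNReal.ofReal κ ^ (-s) := by
  calc mutualEnergy s ℓ μ ν ≤ ∫⁻ _, ∫⁻ _, ENNReal.ofReal κ ^ (-s) ∂ν ∂μ := by
        refine lintegral_mono_ae ?_
        filter_upwards [ae_iff.2 hμ] with x hx
        refine lintegral_mono_ae ?_
        filter_upwards [ae_iff.2 hν] with y hy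
        refine rpow_neg_le_rpow_neg hs (le_max_of_le_left ?_)
        rw [edist_dist]
        exact ENNReal.ofReal_le_ofReal (hST x hx y hy)
    _ = ENNReal.ofReal κ ^ (-s) := by simp

variable {ι : Type*} [Fintype ι] [Nonempty ι]

theorem energy_uniformMixture (ν : ι → ProbabilityMeasure (E d)) :
    energy s ℓ (uniformMixture ν) = (Fintype.card ι : ℝ≥0∞)⁻¹ * ∑ i,
      (Fintype.card ι : ℝ≥0∞)⁻¹ * ∑ j, mutualEnergy s ℓ (ν i : Measure (E d)) (ν j) := by
  have hmeas (j : ι) : Measurable fun x =>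
      ∫⁻ y, (max (edist x y) (ENNReal.ofReal ℓ)) ^ (-s) ∂(ν j : Measure (E d)) :=
    (measurable_energyKernel s ℓ).lintegral_prod_right'
  simp only [energy, mutualEnergy, uniformMixture, ProbabilityMeasure.coe_mk,
    lintegral_smul_measure, lintegral_finsetSum_measure, smul_eq_mul]
  congr 1
  refine Finset.sum_congr rfl fun i _ => ?_
  rw [lintegral_const_mul _ (Finset.measurable_fun_sum _ fun j _ => hmeas j),
    lintegral_finsetSum _ fun j _ => hmeas j]

theorem energy_uniformMixture_le (hs : 0 ≤ s) {κ : ℝ} {ν : ι → ProbabilityMeasure (E d)}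
    {S : ι → Set (E d)} (hν : ∀ i, (ν i : Measure (E d)) (S i)ᶜ = 0)
    (hS : Pairwise fun i j => ∀ x ∈ S i, ∀ y ∈ S j, κ ≤ dist x y) :
    energy s ℓ (uniformMixture ν) ≤ (Fintype.card ι : ℝ≥0∞)⁻¹ * ((Fintype.card ι : ℝ≥0∞)⁻¹ *
      ∑ i, energy s ℓ (ν i)) + ENNReal.ofReal κ ^ (-s) := by
  set N : ℝ≥0∞ := (Fintype.card ι : ℝ≥0∞) with hN
  have N_inv_mul : N⁻¹ * N = 1 := ENNReal.inv_mul_cancel (by simp [hN]) (by simp [hN])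
  have row (i : ι) : ∑ j, mutualEnergy s ℓ (ν i : Measure (E d)) (ν j) ≤
      energy s ℓ (ν i) + N * ENNReal.ofReal κ ^ (-s) := by
    classical
    rw [← Finset.add_sum_erase _ _ (Finset.mem_univ i), hN, ← nsmul_eq_mul]
    refine add_le_add le_rfl ((Finset.sum_le_card_nsmul _ _ _ fun j hj => ?_).trans
      (nsmul_le_nsmul_left zero_le (Finset.card_le_univ _)))
    exact mutualEnergy_le_of_le_dist hs (hν i) (hν j) (hS (Finset.ne_of_mem_erase hj).symm)
  calc energy s ℓ (uniformMixture ν)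
      ≤ N⁻¹ * ∑ i, N⁻¹ * (energy s ℓ (ν i) + N * ENNReal.ofReal κ ^ (-s)) := by
        rw [energy_uniformMixture]
        gcongr with i
        exact row i
    _ = N⁻¹ * (N⁻¹ * ∑ i, energy s ℓ (ν i)) +
          (N⁻¹ * N) * ((N⁻¹ * N) * ENNReal.ofReal κ ^ (-s)) := by
        rw [← Finset.mul_sum, Finset.sum_add_distrib, Finset.sum_const, Finset.card_univ,
          nsmul_eq_mul, ← hN]
        ring
    _ = _ := by rw [N_inv_mul, one_mul, one_mul]

end Energy

/-! ### Nested chains of segments -/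

section Chain

/-- Nested segments of the path `F` over the unit interval, of sizes `L 0, …, L k`. -/
structure IsSegmentChain {X : Type*} [PseudoMetricSpace X] (F : ℝ → X) (L : ℕ → ℝ) (k : ℕ)
    (a b : ℕ → ℝ) : Prop where
  zero_le : 0 ≤ a 0
  le_one : b 0 ≤ 1
  isSegment : ∀ i ≤ k, IsSegment F (L i) (a i) (b i)
  left_le_left : ∀ i < k, a i ≤ a (i + 1)
  right_le_right : ∀ i < k, b (i + 1) ≤ b i

section Update

variable {X : Type*} [PseudoMetricSpace X] {F : ℝ → X} {L : ℕ → ℝ} {k : ℕ} {a b : ℕ → ℝ}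

theorem IsSegment.isSegmentChain_zero {u v : ℝ} (h : IsSegment F (L 0) u v) (hu : 0 ≤ u)
    (hv : v ≤ 1) : IsSegmentChain F L 0 (fun _ => u) (fun _ => v) where
  zero_le := hu
  le_one := hv
  isSegment i hi := by rwa [Nat.le_zero.1 hi]
  left_le_left _ hi := absurd hi (Nat.not_lt_zero _)
  right_le_right _ hi := absurd hi (Nat.not_lt_zero _)

theorem IsSegmentChain.update (h : IsSegmentChain F L k a b) {u v : ℝ} (hu : a k ≤ u)
    (hv : v ≤ b k) (hs : IsSegment F (L (k + 1)) u v) :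
    IsSegmentChain F L (k + 1) (Function.update a (k + 1) u) (Function.update b (k + 1) v) where
  zero_le := by simpa using h.zero_le
  le_one := by simpa using h.le_one
  isSegment i hi := by
    rcases hi.lt_or_eq with hlt | rfl
    · simpa [hlt.ne] using h.isSegment i (by omega)
    · simpa using hs
  left_le_left i hi := by
    rcases (Nat.le_of_lt_succ hi).lt_or_eq with hlt | rfl
    · simpa [hi.ne, hlt.ne] using h.left_le_left i hlt
    · simpa using hu
  right_le_right i hi := by
    rcases (Nat.le_of_lt_succ hi).lt_or_eq with hlt | rfl
    · simpa [hi.ne, hlt.ne] using h.right_le_right i hlt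
    · simpa using hv

end Update

section Weight

variable {V : Type*} [NormedAddCommGroup V] [InnerProductSpace ℝ V] {F : ℝ → V} {q k : ℕ}
  {a b : ℕ → ℝ}

/-- The probability of a chain of segments in the random tree in which one of the children of a
segment is chosen uniformly at each level. -/
def chainWeight (F : ℝ → V) (q k : ℕ) (a b : ℕ → ℝ) : ℝ≥0∞ :=
  ∏ i ∈ Finset.range k, (branching F q (a i) (b i) : ℝ≥0∞)⁻¹

theorem chainWeight_zero : chainWeight F q 0 a b = 1 := Finset.prod_range_zero _

theorem chainWeight_update_succ (u v : ℝ) :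
    chainWeight F q (k + 1) (Function.update a (k + 1) u) (Function.update b (k + 1) v) =
      chainWeight F q k a b * (branching F q (a k) (b k) : ℝ≥0∞)⁻¹ := by
  rw [chainWeight, chainWeight, ← Finset.prod_range_succ]
  refine Finset.prod_congr rfl fun i hi => ?_
  simp [(Finset.mem_range.1 hi).ne]

theorem chainWeight_le_one (hq : 0 < q) : chainWeight F q k a b ≤ 1 :=
  Finset.prod_le_one' fun _ _ => ENNReal.inv_le_one.2 (by exact_mod_cast branching_pos hq)

end Weight

section Tree

variable {d : ℕ} {F : ℝ → E d} {q : ℕ} {s ℓ : ℝ} {L : ℕ → ℝ}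

theorem IsSegmentChain.exists_measure_of_children (hF : Continuous F) (hq : 2 ≤ q) (hs : 0 ≤ s)
    {k : ℕ} (hL : 0 ≤ L (k + 1)) (hLq : L (k + 1) ≤ L k / q ^ 4) {a b : ℕ → ℝ}
    (h : IsSegmentChain F L k a b) {C : ℝ≥0∞}
    (children : ∀ a' b', IsSegmentChain F L (k + 1) a' b' → ∃ ν : ProbabilityMeasure (E d),
      (ν : Measure (E d)) (F '' Set.Icc (a' (k + 1)) (b' (k + 1)))ᶜ = 0 ∧
      chainWeight F q (k + 1) a' b' * energy s ℓ ν ≤ C) :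
    ∃ ν : ProbabilityMeasure (E d), (ν : Measure (E d)) (F '' Set.Icc (a k) (b k))ᶜ = 0 ∧
      chainWeight F q k a b * energy s ℓ ν ≤
        chainWeight F q k a b * ENNReal.ofReal (L k / q ^ 4 - L (k + 1)) ^ (-s) + C := by
  have hq0 : (q : ℝ) ^ 4 ≠ 0 := by positivity
  have hseg := h.isSegment k le_rfl
  set N := branching F q (a k) (b k)
  obtain ⟨u, v, huv⟩ : ∃ u v : Fin N → ℝ,
      SeparatedSegments F (a k) (b k) (L (k + 1)) (L k / q ^ 4 - L (k + 1)) u v :=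
    exists_separatedSegments_branching hF hq hseg.le hL hLq
      (by rw [hseg.dist_eq, mul_div_cancel₀ _ hq0])
  have hN0 : 0 < N := branching_pos (by omega)
  have : Nonempty (Fin N) := ⟨⟨0, hN0⟩⟩
  set w := chainWeight F q k a b
  have exists_child (i : Fin N) : ∃ ν : ProbabilityMeasure (E d),
      (ν : Measure (E d)) (F '' Set.Icc (u i) (v i))ᶜ = 0 ∧
      w * (N : ℝ≥0∞)⁻¹ * energy s ℓ ν ≤ C := by
    obtain ⟨ν, hν, hνE⟩ := children _ _
      (h.update (huv.left_le i) (huv.le_right i) (huv.isSegment i))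
    rw [chainWeight_update_succ] at hνE
    rw [Function.update_self, Function.update_self] at hν
    exact ⟨ν, hν, hνE⟩
  choose ν hν hνE using exists_child
  refine ⟨uniformMixture ν, uniformMixture_eq_zero fun i => measure_mono_null
    (Set.compl_subset_compl.2 (Set.image_mono (Set.Icc_subset_Icc (huv.left_le i)
      (huv.le_right i)))) (hν i), ?_⟩
  have hE := energy_uniformMixture_le (ℓ := ℓ) (κ := L k / q ^ 4 - L (k + 1)) hs hν fun i j hij =>
    Set.forall_mem_image.2 fun x hx => Set.forall_mem_image.2 fun y hy => huv.le_dist hij x hx y hy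
  rw [Fintype.card_fin] at hE
  calc w * energy s ℓ (uniformMixture ν)
      ≤ w * ((N : ℝ≥0∞)⁻¹ * ((N : ℝ≥0∞)⁻¹ * ∑ i, energy s ℓ (ν i))
          + ENNReal.ofReal (L k / q ^ 4 - L (k + 1)) ^ (-s)) := by gcongr
    _ = w * ENNReal.ofReal (L k / q ^ 4 - L (k + 1)) ^ (-s) +
          (N : ℝ≥0∞)⁻¹ * ∑ i, w * (N : ℝ≥0∞)⁻¹ * energy s ℓ (ν i) := by
        rw [← Finset.mul_sum]
        ring
    _ ≤ w * ENNReal.ofReal (L k / q ^ 4 - L (k + 1)) ^ (-s) +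
          (N : ℝ≥0∞)⁻¹ * ∑ _i : Fin N, C := by
        gcongr with i
        exact hνE i
    _ = w * ENNReal.ofReal (L k / q ^ 4 - L (k + 1)) ^ (-s) + C := by
        rw [Finset.sum_const, Finset.card_univ, Fintype.card_fin, nsmul_eq_mul, ← mul_assoc,
          ENNReal.inv_mul_cancel (by exact_mod_cast hN0.ne') (ENNReal.natCast_ne_top N), one_mul]

theorem IsSegmentChain.exists_measure_energy_le (hF : Continuous F) (hq : 2 ≤ q) (hs : 0 ≤ s)
    (hL : ∀ i, 0 ≤ L i) (hLq : ∀ i, L (i + 1) ≤ L i / q ^ 4) {n : ℕ} {B : ℕ → ℝ≥0∞}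
    (hB : ∀ k ≤ n, ∀ a b, IsSegmentChain F L k a b → chainWeight F q k a b ≤ B k)
    {k : ℕ} (hk : k ≤ n) : ∀ a b, IsSegmentChain F L k a b → ∃ ν : ProbabilityMeasure (E d),
      (ν : Measure (E d)) (F '' Set.Icc (a k) (b k))ᶜ = 0 ∧
      chainWeight F q k a b * energy s ℓ ν ≤ ∑ i ∈ Finset.Ico k n,
        B i * ENNReal.ofReal (L i / q ^ 4 - L (i + 1)) ^ (-s) + B n * ENNReal.ofReal ℓ ^ (-s) := by
  induction hk using Nat.decreasingInduction with
  | self =>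
    intro a b h
    have mem : F (a n) ∈ F '' Set.Icc (a n) (b n) :=
      Set.mem_image_of_mem F ⟨le_rfl, (h.isSegment n le_rfl).le⟩
    refine ⟨⟨Measure.dirac (F (a n)), inferInstance⟩, ?_, ?_⟩
    · rw [ProbabilityMeasure.coe_mk, Measure.dirac_apply,
        Set.indicator_of_notMem (Set.notMem_compl_iff.2 mem)]
    · rw [energy_dirac, Finset.Ico_self, Finset.sum_empty, zero_add]
      gcongr
      exact hB n le_rfl a b h
  | of_succ k hk ih =>
    intro a b h
    obtain ⟨ν, hν, hE⟩ := h.exists_measure_of_children hF hq hs (hL _) (hLq k) ih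
    refine ⟨ν, hν, hE.trans ?_⟩
    rw [Finset.sum_eq_sum_Ico_succ_bot hk, add_assoc]
    gcongr
    exact hB k hk.le a b h

end Tree

end Chain

/-! ### Energy bounds for paths whose straight segments are sparse -/

section Scale

variable {q : ℕ} {r : ℝ}

/-- The ratio `γ = q ^ 4 + q` of the sizes of consecutive segments of a chain. It lies between the
number `q ^ 4` of children of a straight segment and the geometric mean of the numbers of children
of straight and other segments, which exceeds `γ`. -/
def scaleRatio (q : ℕ) : ℝ := q ^ 4 + q

/-- The scales `r γ^{-i}`, where `γ` is the scale ratio. -/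
def scale (r : ℝ) (q i : ℕ) : ℝ := r / scaleRatio q ^ i

/-- The exponent `D` for which `γ ^ (2 D)` is the number `q ^ 4 (q ^ 4 + q ^ 2)` of grandchildren of
a segment of which one generation is straight. -/
def roughDim (q : ℕ) : ℝ := Real.logb (scaleRatio q) (q ^ 4 * (q ^ 4 + q ^ 2)) / 2

theorem one_lt_scaleRatio (hq : 2 ≤ q) : 1 < scaleRatio q := by
  have hq' : (2 : ℝ) ≤ q := by exact_mod_cast hq
  unfold scaleRatio
  linarith [show (0 : ℝ) ≤ (q : ℝ) ^ 4 by positivity]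

theorem scaleRatio_pos (hq : 2 ≤ q) : 0 < scaleRatio q := one_pos.trans (one_lt_scaleRatio hq)

theorem scale_zero (r : ℝ) (q : ℕ) : scale r q 0 = r := by simp [scale]

theorem scale_succ (r : ℝ) (q i : ℕ) : scale r q (i + 1) = scale r q i / scaleRatio q := by
  rw [scale, scale, pow_succ, div_div]

theorem scale_div_pow_sub_scale_succ (r : ℝ) (q i : ℕ) :
    scale r q i / q ^ 4 - scale r q (i + 1) = (1 / q ^ 4 - 1 / scaleRatio q) * scale r q i := by
  rw [scale_succ]
  ring

theorem scale_pos (hr : 0 < r) (hq : 2 ≤ q) (i : ℕ) : 0 < scale r q i :=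
  div_pos hr (pow_pos (scaleRatio_pos hq) i)

theorem scale_succ_le (hr : 0 < r) (hq : 2 ≤ q) (i : ℕ) :
    scale r q (i + 1) ≤ scale r q i / q ^ 4 := by
  rw [scale_succ]
  exact div_le_div_of_nonneg_left (scale_pos hr hq i).le (by positivity)
    (le_add_of_nonneg_right q.cast_nonneg)

theorem one_lt_roughDim (hq : 3 ≤ q) : 1 < roughDim q := by
  have hq' : (3 : ℝ) ≤ q := by exact_mod_cast hq
  rw [roughDim, one_lt_div two_pos, Real.lt_logb_iff_rpow_lt (one_lt_scaleRatio (by omega))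
    (by positivity), Real.rpow_two, scaleRatio]
  have one_lt_cube : (1 : ℝ) < q ^ 3 := one_lt_pow₀ (by linarith) three_ne_zero
  have : (0 : ℝ) < q ^ 4 - 2 * q ^ 3 - 1 := by
    linarith [mul_nonneg (sub_nonneg.2 hq') (by positivity : (0 : ℝ) ≤ q ^ 3)]
  linarith [mul_pos (by positivity : (0 : ℝ) < q ^ 2) this]

theorem scaleRatio_rpow_neg_roughDim_sq (hq : 2 ≤ q) :
    (scaleRatio q ^ (-roughDim q)) ^ 2 = ((q : ℝ) ^ 4)⁻¹ * ((q : ℝ) ^ 4 + q ^ 2)⁻¹ := by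
  have hγ := one_lt_scaleRatio hq
  rw [← Real.rpow_mul_natCast (scaleRatio_pos hq).le, ← mul_inv, roughDim, Nat.cast_ofNat, neg_mul,
    div_mul_cancel₀ _ two_ne_zero, Real.rpow_neg (scaleRatio_pos hq).le,
    Real.rpow_logb (scaleRatio_pos hq) hγ.ne' (by positivity)]

theorem ofReal_mul_ofReal_mul_scale_rpow (hq : 2 ≤ q) (hr : 0 < r) {A C : ℝ} (hA : 0 ≤ A)
    (hC : 0 < C) (s D : ℝ) (i : ℕ) :
    ENNReal.ofReal (A * (scaleRatio q ^ (-D)) ^ i) * ENNReal.ofReal (C * scale r q i) ^ (-s) =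
      ENNReal.ofReal (A * (C * r) ^ (-s) * (scaleRatio q ^ (s - D)) ^ i) := by
  have hγ := scaleRatio_pos hq
  have scale_rpow : (C * scale r q i) ^ (-s) = (C * r) ^ (-s) * (scaleRatio q ^ s) ^ i := by
    rw [scale, ← mul_div_assoc, Real.div_rpow (by positivity) (by positivity),
      ← Real.rpow_pow_comm hγ.le, Real.rpow_neg hγ.le, inv_pow, div_inv_eq_mul]
  have := scale_pos hr hq i
  rw [ENNReal.ofReal_rpow_of_pos (by positivity), ← ENNReal.ofReal_mul (by positivity), scale_rpow,
    sub_eq_add_neg, Real.rpow_add hγ, mul_pow]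
  congr 1
  ring

end Scale

section Sparse

variable {V : Type*} [NormedAddCommGroup V] [InnerProductSpace ℝ V] {F : ℝ → V} {q k : ℕ}
  {a b : ℕ → ℝ}

open Classical in
/-- The levels `i < k` at which the segment of the chain is straight. -/
def straightLevels (F : ℝ → V) (q k : ℕ) (a b : ℕ → ℝ) : Finset ℕ :=
  {i ∈ Finset.range k | IsStraight F (2 * dist (F (a i)) (F (b i)) / q) (a i) (b i)}

open Classical in
theorem mem_straightLevels {i : ℕ} : i ∈ straightLevels F q k a b ↔
    i < k ∧ IsStraight F (2 * dist (F (a i)) (F (b i)) / q) (a i) (b i) := by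
  rw [straightLevels, Finset.mem_filter, Finset.mem_range]

theorem straightLevels_subset_range : straightLevels F q k a b ⊆ Finset.range k := fun _ hi =>
  Finset.mem_range.2 (mem_straightLevels.1 hi).1

/-- Along every chain of segments of length `k ∈ [k₀, n]` of the path, whose sizes are the scales
`r γ^{-i}`, at most half of the levels are straight. -/
def HasSparseStraightLevels (F : ℝ → V) (q : ℕ) (r : ℝ) (k₀ n : ℕ) : Prop :=
  ∀ k, k₀ ≤ k → k ≤ n → ∀ a b, IsSegmentChain F (scale r q) k a b →
    2 * (straightLevels F q k a b).card ≤ k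

theorem pow_mul_pow_le_of_sq_eq {x y β : ℝ} (hy : 0 ≤ y) (hyx : y ≤ x) (hβ : 0 ≤ β)
    (h : β ^ 2 = x * y) {c k : ℕ} (hc : 2 * c ≤ k) : x ^ c * y ^ (k - c) ≤ β ^ k := by
  have hyβ : y ≤ β :=
    le_of_sq_le_sq (by rw [h, sq]; exact mul_le_mul_of_nonneg_right hyx hy) hβ
  obtain ⟨e, rfl⟩ := Nat.exists_eq_add_of_le hc
  calc x ^ c * y ^ (2 * c + e - c) = (x * y) ^ c * y ^ e := by
        rw [show 2 * c + e - c = c + e by omega, pow_add, mul_pow, mul_assoc]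
    _ = β ^ (2 * c) * y ^ e := by rw [← h, pow_mul]
    _ ≤ β ^ (2 * c) * β ^ e := by gcongr
    _ = β ^ (2 * c + e) := (pow_add ..).symm

theorem chainWeight_eq (hq : 0 < q) : chainWeight F q k a b = ENNReal.ofReal
    (((q : ℝ) ^ 4)⁻¹ ^ (straightLevels F q k a b).card *
      ((q : ℝ) ^ 4 + q ^ 2)⁻¹ ^ (k - (straightLevels F q k a b).card)) := by
  classical
  set straight : ℕ → Prop := fun i => IsStraight F (2 * dist (F (a i)) (F (b i)) / q) (a i) (b i)
  have branching_inv (i : ℕ) : (branching F q (a i) (b i) : ℝ≥0∞)⁻¹ =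
      ENNReal.ofReal (if straight i then ((q : ℝ) ^ 4)⁻¹ else ((q : ℝ) ^ 4 + q ^ 2)⁻¹) := by
    rw [← ENNReal.ofReal_natCast, ← ENNReal.ofReal_inv_of_pos (by exact_mod_cast branching_pos hq)]
    unfold branching
    split_ifs <;> push_cast <;> rfl
  have card_filter_not : ({i ∈ Finset.range k | ¬ straight i}).card =
      k - (straightLevels F q k a b).card := by
    rw [Finset.filter_not, Finset.card_sdiff_of_subset (Finset.filter_subset _ _),
      Finset.card_range]
    congr!
  rw [chainWeight, Finset.prod_congr rfl fun i _ => branching_inv i,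
    ← ENNReal.ofReal_prod_of_nonneg (fun i _ => by split_ifs <;> positivity), Finset.prod_ite,
    Finset.prod_const, Finset.prod_const, card_filter_not]
  congr!

theorem chainWeight_le_of_sparse (hq : 2 ≤ q) (h : 2 * (straightLevels F q k a b).card ≤ k) :
    chainWeight F q k a b ≤ ENNReal.ofReal ((scaleRatio q ^ (-roughDim q)) ^ k) := by
  have := scaleRatio_pos hq
  rw [chainWeight_eq (by omega)]
  exact ENNReal.ofReal_le_ofReal (pow_mul_pow_le_of_sq_eq (by positivity)
    (inv_anti₀ (by positivity) (le_add_of_nonneg_right (by positivity))) (by positivity)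
    (scaleRatio_rpow_neg_roughDim_sq hq) h)

theorem HasSparseStraightLevels.chainWeight_le {r : ℝ} {k₀ n : ℕ} (hq : 3 ≤ q)
    (h : HasSparseStraightLevels F q r k₀ n) (hk : k ≤ n)
    (hchain : IsSegmentChain F (scale r q) k a b) : chainWeight F q k a b ≤
      ENNReal.ofReal ((scaleRatio q ^ roughDim q) ^ k₀ * (scaleRatio q ^ (-roughDim q)) ^ k) := by
  have hγ := scaleRatio_pos (q := q) (by omega)
  have one_le : 1 ≤ scaleRatio q ^ roughDim q :=
    Real.one_le_rpow (one_lt_scaleRatio (by omega)).le (one_pos.trans (one_lt_roughDim hq)).le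
  rcases le_total k₀ k with hk₀ | hk₀
  · refine (chainWeight_le_of_sparse (by omega) (h k hk₀ hk a b hchain)).trans
      (ENNReal.ofReal_le_ofReal ?_)
    exact le_mul_of_one_le_left (by positivity) (one_le_pow₀ one_le)
  · refine (chainWeight_le_one (by omega)).trans (ENNReal.one_le_ofReal.2 ?_)
    rw [Real.rpow_neg hγ.le, inv_pow, ← div_eq_mul_inv, one_le_div (by positivity)]
    exact pow_le_pow_right₀ one_le hk₀

end Sparse

theorem sum_ofReal_mul_pow_le {c x : ℝ} (hc : 0 ≤ c) (hx0 : 0 ≤ x) (hx1 : x < 1) (t : Finset ℕ) :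
    ∑ i ∈ t, ENNReal.ofReal (c * x ^ i) ≤ ENNReal.ofReal (c * (1 - x)⁻¹) := by
  rw [← ENNReal.ofReal_sum_of_nonneg fun i _ => by positivity, ← Finset.mul_sum,
    ← tsum_geometric_of_lt_one hx0 hx1]
  gcongr
  exact (summable_geometric_of_lt_one hx0 hx1).sum_le_tsum _ fun i _ => by positivity

theorem exists_energy_le_of_hasSparseStraightLevels {d q : ℕ} (hq : 3 ≤ q) {s : ℝ} (hs : 0 ≤ s)
    (hsd : s < roughDim q) {r A : ℝ} (hr : 0 < r) (hA : 0 < A) (k₀ : ℕ) :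
    ∃ u : ℝ≥0, ∀ (F : ℝ → E d) (δ : ℝ) (n : ℕ), Continuous F → scale r q n ≤ A * δ →
      HasSparseStraightLevels F q r k₀ n →
      ∀ a b, 0 ≤ a → a ≤ b → b ≤ 1 → r ≤ dist (F a) (F b) →
        ∃ ν : ProbabilityMeasure (E d), (ν : Measure (E d)) (F '' Set.Icc 0 1)ᶜ = 0 ∧
          energy s δ ν ≤ u := by
  have hq2 : 2 ≤ q := by omega
  have hγ := scaleRatio_pos hq2
  set x : ℝ := scaleRatio q ^ (s - roughDim q)
  have hx1 : x < 1 := Real.rpow_lt_one_of_one_lt_of_neg (one_lt_scaleRatio hq2) (sub_neg.2 hsd)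
  set c : ℝ := 1 / q ^ 4 - 1 / scaleRatio q
  have hc : 0 < c := sub_pos.2 (one_div_lt_one_div_of_lt (by positivity)
    (lt_add_of_pos_right _ (by positivity)))
  set b₀ : ℝ := (scaleRatio q ^ roughDim q) ^ k₀
  set U : ℝ≥0∞ := ENNReal.ofReal (b₀ * (c * r) ^ (-s) * (1 - x)⁻¹) +
    ENNReal.ofReal (b₀ * (A⁻¹ * r) ^ (-s))
  have hU : U ≠ ∞ := ENNReal.add_ne_top.2 ⟨ENNReal.ofReal_ne_top, ENNReal.ofReal_ne_top⟩
  refine ⟨U.toNNReal, fun F δ n hF hn hsparse a b ha hab hb hrab => ?_⟩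
  obtain ⟨v, hv, hseg⟩ := exists_isSegment hF hab hr.le hrab
  obtain ⟨ν, hν, hE⟩ := IsSegmentChain.exists_measure_energy_le (ℓ := δ) hF hq2 hs
    (fun i => (scale_pos hr hq2 i).le) (scale_succ_le hr hq2)
    (fun k hk a b h => hsparse.chainWeight_le hq hk h) n.zero_le _ _
    (IsSegment.isSegmentChain_zero (by rwa [scale_zero]) ha (hv.2.trans hb))
  refine ⟨ν, measure_mono_null (Set.compl_subset_compl.2 (Set.image_mono
    (Set.Icc_subset_Icc ha (hv.2.trans hb)))) hν, ?_⟩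
  have last_le : ENNReal.ofReal δ ^ (-s) ≤ ENNReal.ofReal (A⁻¹ * scale r q n) ^ (-s) :=
    rpow_neg_le_rpow_neg hs (ENNReal.ofReal_le_ofReal ((inv_mul_le_iff₀ hA).2 hn))
  rw [chainWeight_zero, one_mul] at hE
  rw [ENNReal.coe_toNNReal hU]
  refine hE.trans (add_le_add ?_ ((mul_le_mul_right last_le _).trans ?_))
  · refine (Finset.sum_le_sum fun i _ => ?_).trans
      (sum_ofReal_mul_pow_le (by positivity) (by positivity) hx1 _)
    rw [scale_div_pow_sub_scale_succ, ofReal_mul_ofReal_mul_scale_rpow hq2 hr (by positivity) hc]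
  · rw [ofReal_mul_ofReal_mul_scale_rpow hq2 hr (by positivity) (by positivity)]
    exact ENNReal.ofReal_le_ofReal
      (mul_le_of_le_one_right (by positivity) (pow_le_one₀ (by positivity) hx1.le))

/-! ### Crossings of cylinders by straight segments -/

section LineDist

variable {V : Type*} [NormedAddCommGroup V] [InnerProductSpace ℝ V]

theorem lineDist_smul {c : ℝ} (hc : c ≠ 0) (x v z : V) : lineDist x (c • v) z = lineDist x v z := by
  simp only [lineDist, Submodule.span_singleton_smul_eq hc.isUnit]

theorem lineDist_le_norm_sub (x v z : V) (c : ℝ) : lineDist x v z ≤ ‖z - (x + c • v)‖ := by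
  have proj_eq : (ℝ ∙ v)ᗮ.starProjection (z - (x + c • v)) = (ℝ ∙ v)ᗮ.starProjection (z - x) := by
    rw [← sub_sub, map_sub, map_smul,
      Submodule.starProjection_orthogonalComplement_singleton_eq_zero, smul_zero, sub_zero]
  rw [lineDist, ← proj_eq]
  exact Submodule.norm_starProjection_apply_le _ _

theorem dist_le_abs_inner_add_lineDist {e : V} (he : ‖e‖ = 1) (x z : V) :
    dist z x ≤ |inner ℝ e (z - x)| + lineDist x e z := by
  have := lineDist_nonneg x e z
  rw [dist_eq_norm]
  refine le_of_sq_le_sq ?_ (by positivity)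
  rw [norm_sq_eq_inner_sq_add_lineDist_sq he, add_sq, sq_abs]
  linarith [mul_nonneg (abs_nonneg (inner ℝ e (z - x))) this]

theorem abs_inner_le_norm_of_norm_eq_one {e : V} (he : ‖e‖ = 1) (z : V) : |inner ℝ e z| ≤ ‖z‖ := by
  simpa only [he, one_mul] using abs_real_inner_le_norm e z

theorem abs_inner_sub_inner_le_dist {e : V} (he : ‖e‖ = 1) (x z z' : V) :
    |inner ℝ e (z - x) - inner ℝ e (z' - x)| ≤ dist z z' := by
  rw [← inner_sub_right, sub_sub_sub_cancel_right, dist_eq_norm]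
  exact abs_inner_le_norm_of_norm_eq_one he _

theorem lineDist_le_add_of_dist_le {x y x' y' z : V} {τ : ℝ} (hz : dist x z ≤ dist x y)
    (hx : dist x x' ≤ τ) (hy : dist y y' ≤ τ) :
    lineDist x' (y' - x') z ≤ lineDist x (y - x) z + 3 * τ := by
  rw [dist_eq_norm'] at hz
  rw [dist_eq_norm] at hx hy
  set c : ℝ := inner ℝ (y - x) (z - x) / ‖y - x‖ ^ 2
  set v := (ℝ ∙ (y - x))ᗮ.starProjection (z - x) with hv
  have hc : |c| ≤ 1 := by
    rw [abs_div, abs_of_nonneg (sq_nonneg ‖y - x‖)]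
    refine div_le_one_of_le₀ ((abs_real_inner_le_norm _ _).trans ?_) (sq_nonneg _)
    rw [dist_eq_norm'] at hz
    rw [sq]
    gcongr
  have decomposition : z - (x' + c • (y' - x')) = v + ((1 - c) • (x - x') + c • (y - y')) := by
    have : z - x = c • (y - x) + v := by
      rw [hv, Submodule.starProjection_orthogonal_val, Submodule.starProjection_singleton]
      exact (add_sub_cancel _ _).symm
    rw [sub_eq_iff_eq_add'.1 this]
    module
  have norm_one_sub : |1 - c| ≤ 2 := by
    rw [abs_le] at hc ⊢
    constructor <;> linarith
  calc lineDist x' (y' - x') z ≤ ‖v + ((1 - c) • (x - x') + c • (y - y'))‖ := by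
        rw [← decomposition]
        exact lineDist_le_norm_sub ..
    _ ≤ ‖v‖ + (|1 - c| * ‖x - x'‖ + |c| * ‖y - y'‖) := by
        rw [← Real.norm_eq_abs, ← Real.norm_eq_abs, ← norm_smul, ← norm_smul]
        exact norm_add_le_of_le le_rfl (norm_add_le _ _)
    _ ≤ lineDist x (y - x) z + (2 * τ + 1 * τ) := by
        gcongr
        exact le_rfl
    _ = lineDist x (y - x) z + 3 * τ := by ring

end LineDist

section AxisCylinder

variable {d : ℕ}

/-- The cylinder of radius `w` around the axis from `x + h e` to `x + (h + l) e`. -/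
def axisCylinder (x e : E d) (h l w : ℝ) (he : ‖e‖ = 1) (hl : 0 < l) (hw : 0 < w) :
    Cylinder d where
  base := x + h • e
  top := x + (h + l) • e
  radius := w
  base_ne_top := by
    have : l • e ≠ 0 := smul_ne_zero hl.ne' (norm_ne_zero_iff.1 (by simp [he]))
    rwa [add_smul, ← add_assoc, ne_comm, Ne, add_eq_left]
  radius_pos := hw

variable {x e z : E d} {h l w t : ℝ} {he : ‖e‖ = 1} {hl : 0 < l} {hw : 0 < w}

theorem axisCylinder_top_sub_base :
    (axisCylinder x e h l w he hl hw).top - (axisCylinder x e h l w he hl hw).base = l • e := by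
  simp only [axisCylinder, add_smul]
  abel

theorem length_axisCylinder : (axisCylinder x e h l w he hl hw).length = l := by
  rw [Cylinder.length, dist_eq_norm', axisCylinder_top_sub_base, norm_smul, he, mul_one,
    Real.norm_of_nonneg hl.le]

theorem mem_slice_axisCylinder : z ∈ (axisCylinder x e h l w he hl hw).slice t ↔
    inner ℝ e (z - x) = h + t * l ∧ lineDist x e z ≤ w := by
  have mem_iff : z ∈ (axisCylinder x e h l w he hl hw).slice t ↔
      ∃ v : E d, inner ℝ v (l • e) = 0 ∧ ‖v‖ ≤ w ∧ z = x + h • e + t • l • e + v := by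
    rw [Cylinder.slice, axisCylinder_top_sub_base]
    rfl
  have inner_self : inner ℝ e e = (1 : ℝ) := by rw [real_inner_self_eq_norm_sq, he, one_pow]
  rw [mem_iff]
  constructor
  · rintro ⟨v, hv, hvw, rfl⟩
    have hv0 : inner ℝ e v = (0 : ℝ) := by
      rw [real_inner_smul_right, mul_eq_zero, real_inner_comm] at hv
      exact hv.resolve_left hl.ne'
    have sub_eq : x + h • e + t • l • e + v - x = (h + t * l) • e + v := by module
    refine ⟨?_, (lineDist_le_norm_sub x e _ (h + t * l)).trans ?_⟩
    · rw [sub_eq, inner_add_right, real_inner_smul_right, inner_self, hv0, mul_one, add_zero]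
    · rwa [show x + h • e + t • l • e + v - (x + (h + t * l) • e) = v by module]
  · rintro ⟨hz, hzw⟩
    refine ⟨(ℝ ∙ e)ᗮ.starProjection (z - x), ?_, hzw, ?_⟩
    · rw [real_inner_smul_right, Submodule.mem_orthogonal_singleton_iff_inner_left.1
        (Submodule.starProjection_apply_mem _ _), mul_zero]
    · rw [Submodule.starProjection_orthogonal_val, Submodule.starProjection_unit_singleton ℝ he, hz]
      module

theorem mem_carrier_axisCylinder : z ∈ (axisCylinder x e h l w he hl hw).carrier ↔
    inner ℝ e (z - x) ∈ Set.Icc h (h + l) ∧ lineDist x e z ≤ w := by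
  simp only [Cylinder.carrier, Set.mem_iUnion, mem_slice_axisCylinder, exists_prop]
  constructor
  · rintro ⟨t, ht, hz, hzw⟩
    rw [hz]
    exact ⟨⟨le_add_of_nonneg_right (mul_nonneg ht.1 hl.le),
      add_le_add_right (mul_le_of_le_one_left hl.le ht.2) h⟩, hzw⟩
  · rintro ⟨hz, hzw⟩
    refine ⟨(inner ℝ e (z - x) - h) / l, ⟨div_nonneg (sub_nonneg.2 hz.1) hl.le,
      (div_le_one hl).2 (sub_le_iff_le_add'.2 hz.2)⟩, ?_, hzw⟩
    rw [div_mul_cancel₀ _ hl.ne', add_sub_cancel]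

theorem ediam_carrier_axisCylinder_le :
    Metric.ediam (axisCylinder x e h l w he hl hw).carrier ≤ ENNReal.ofReal (l + 2 * w) := by
  refine Metric.ediam_le fun z hz z' hz' => ?_
  obtain ⟨hz, hzw⟩ := mem_carrier_axisCylinder.1 hz
  obtain ⟨hz', hzw'⟩ := mem_carrier_axisCylinder.1 hz'
  have inner_le : |inner ℝ e (z - z')| ≤ l := by
    rw [← sub_sub_sub_cancel_right z z' x, inner_sub_right, abs_le]
    constructor <;> linarith [hz.1, hz.2, hz'.1, hz'.2]
  have lineDist_le : lineDist z' e z ≤ 2 * w := by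
    rw [lineDist, ← sub_sub_sub_cancel_right z z' x, map_sub, two_mul]
    exact (norm_sub_le _ _).trans (add_le_add hzw hzw')
  rw [edist_dist]
  exact ENNReal.ofReal_le_ofReal
    ((dist_le_abs_inner_add_lineDist he z' z).trans (add_le_add inner_le lineDist_le))

end AxisCylinder

section Crosses

variable {d : ℕ} {F : ℝ → E d} {a b : ℝ}

/-- A part of the path `F` over `[a, b]` stays in the cylinder and joins its two end faces. -/
def Crosses (F : ℝ → E d) (a b : ℝ) (A : Cylinder d) : Prop :=
  ∃ s u, a ≤ s ∧ s ≤ u ∧ u ≤ b ∧ F s ∈ A.slice 0 ∧ F u ∈ A.slice 1 ∧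
    ∀ t ∈ Set.Icc s u, F t ∈ A.carrier

theorem crosses_axisCylinder {x e : E d} {h l w : ℝ} {he : ‖e‖ = 1} {hl : 0 < l} {hw : 0 < w}
    (hF : Continuous F) (hab : a ≤ b) (htube : ∀ t ∈ Set.Icc a b, lineDist x e (F t) ≤ w)
    (ha : inner ℝ e (F a - x) ≤ h) (hb : h + l ≤ inner ℝ e (F b - x)) :
    Crosses F a b (axisCylinder x e h l w he hl hw) := by
  obtain ⟨s, u, has, hsu, hub, hs, hu, hheight⟩ := exists_crossing
    (g := fun t => inner ℝ e (F t - x)) (by fun_prop) hab ha (le_add_of_nonneg_right hl.le) hb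
  have tube : ∀ t ∈ Set.Icc s u, lineDist x e (F t) ≤ w :=
    fun t ht => htube t (Set.Icc_subset_Icc has hub ht)
  refine ⟨s, u, has, hsu, hub, mem_slice_axisCylinder.2 ⟨?_, tube s ⟨le_rfl, hsu⟩⟩,
    mem_slice_axisCylinder.2 ⟨?_, tube u ⟨hsu, le_rfl⟩⟩,
    fun t ht => mem_carrier_axisCylinder.2 ⟨hheight t ht, tube t ht⟩⟩
  · rw [hs, zero_mul, add_zero]
  · rw [hu, one_mul]

theorem IsSegment.crosses_axisCylinder {x y : E d} {w h l τ : ℝ}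
    {he : ‖(dist x y)⁻¹ • (y - x)‖ = 1} {hl : 0 < l} {hw : 0 < w + 3 * τ}
    (hF : Continuous F) (hseg : IsSegment F (dist x y) a b) (hst : IsStraight F w a b)
    (hx : dist (F a) x ≤ τ) (hy : dist (F b) y ≤ τ) (hτh : τ ≤ h) (hhl : h + l ≤ dist x y - τ) :
    Crosses F a b (axisCylinder x ((dist x y)⁻¹ • (y - x)) h l (w + 3 * τ) he hl hw) := by
  have hxy : dist x y ≠ 0 := by
    rintro h0
    simp [h0] at he
  refine RandomCurves.crosses_axisCylinder hF hseg.le (fun t ht => ?_) ?_ ?_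
  · rw [lineDist_smul (inv_ne_zero hxy)]
    have := lineDist_le_add_of_dist_le ((hseg.dist_le t ht).trans hseg.dist_eq.ge) hx hy
    exact this.trans (add_le_add_left (hst t ht) _)
  · rw [dist_eq_norm] at hx
    exact (le_abs_self _).trans ((abs_inner_le_norm_of_norm_eq_one he _).trans (hx.trans hτh))
  · have height_y : inner ℝ ((dist x y)⁻¹ • (y - x)) (y - x) = dist x y := by
      rw [real_inner_smul_left, real_inner_self_eq_norm_sq, ← dist_eq_norm', sq,
        inv_mul_cancel_left₀ hxy]
    have := (abs_le.1 (abs_inner_sub_inner_le_dist he x (F b) y)).1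
    linarith

namespace ParamCurve

variable {Λ : Set (E d)}

/-- The parametrized curve, extended to a path over the real line. -/
def path (f : ParamCurve Λ) : ℝ → E d := Set.IccExtend zero_le_one f.eval

theorem continuous_path (f : ParamCurve Λ) : Continuous f.path := f.continuous_eval.Icc_extend'

theorem path_coe (f : ParamCurve Λ) (t : I) : f.path t = f.eval t := Set.IccExtend_val ..

end ParamCurve

theorem Crosses.traverses {Λ : Set (E d)} {f : ParamCurve Λ} {A : Cylinder d}
    (h : Crosses f.path a b A) (ha : 0 ≤ a) (hb : b ≤ 1) :
    Curve.Traverses (SeparationQuotient.mk f : Curve Λ) A := by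
  obtain ⟨s, u, has, hsu, hub, hs, hu, hmem⟩ := h
  refine ⟨f, rfl, ⟨s, ha.trans has, (hsu.trans hub).trans hb⟩,
    ⟨u, (ha.trans has).trans hsu, hub.trans hb⟩, hsu, ?_, ?_, fun t ht => ?_⟩ <;>
    rw [← f.path_coe]
  exacts [hs, hu, hmem t ⟨ht.1, ht.2⟩]

end Crosses

/-! ### Well separated cylinders along a chain -/

section Column

variable {d : ℕ} {σ l w τ : ℝ} {x y p : E d}

/-- With `P + 1` steps of size `Δ` fitting into half of `[τ, L]`, one of the two halves of the
interval contains a progression of `P` intervals that stay away from the height `H`. -/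
theorem exists_heights {L Δ : ℝ} {P : ℕ} (hl : l ≤ Δ) (hΔ : 0 ≤ Δ)
    (hP : (P + 1) * Δ + τ ≤ L / 2) (H : ℝ) :
    ∃ o : ℝ, ∀ j : Fin P, τ ≤ o + j * Δ ∧ o + j * Δ + l ≤ L - τ ∧
      ∀ c ∈ Set.Icc (o + j * Δ) (o + j * Δ + l), Δ ≤ |H - c| := by
  have step_le (j : Fin P) : 0 ≤ j * Δ ∧ (j + 1) * Δ ≤ P * Δ :=
    ⟨by positivity, mul_le_mul_of_nonneg_right (by exact_mod_cast j.2) hΔ⟩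
  rcases le_total (L / 2) H with hH | hH
  · refine ⟨τ, fun j => ?_⟩
    obtain ⟨h0, h1⟩ := step_le j
    exact ⟨by linarith, by linarith, fun c hc => le_abs.2 (.inl (by linarith [hc.2]))⟩
  · refine ⟨L / 2 + Δ, fun j => ?_⟩
    obtain ⟨h0, h1⟩ := step_le j
    have : (0 : ℝ) ≤ P * Δ := by positivity
    exact ⟨by linarith, by linarith, fun c hc => le_abs.2 (.inr (by linarith [hc.1]))⟩

/-- A column of separated cylinders of length `l` and aspect ratio `σ` along the segment from `x` to
`y`, which stays away from the point `p` and is crossed by every path with end points `τ`-close to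
`x` and `y` that is straight up to the error `w`. -/
structure IsCylinderColumn {κ : Type*} (σ l w τ : ℝ) (x y p : E d) (A : κ → Cylinder d) :
    Prop where
  length_eq : ∀ j, (A j).length = l
  width_eq : ∀ j, (A j).width = σ * l
  ediam_le : ∀ j, Metric.ediam (A j).carrier ≤ ENNReal.ofReal (l * (1 + σ))
  le_dist : Pairwise fun j j' =>
    ∀ z ∈ (A j).carrier, ∀ z' ∈ (A j').carrier, l * (1 + σ) ≤ dist z z'
  dist_le : ∀ j, ∀ z ∈ (A j).carrier, dist z x ≤ 2 * dist x y
  le_dist_avoided : ∀ j, ∀ z ∈ (A j).carrier, l * (2 + σ) ≤ dist p z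
  crosses : ∀ j {F : ℝ → E d} {a b : ℝ}, Continuous F → IsSegment F (dist x y) a b →
    IsStraight F w a b → dist (F a) x ≤ τ → dist (F b) y ≤ τ → Crosses F a b (A j)

theorem exists_isCylinderColumn {P : ℕ} (hσ : 0 < σ) (hl : 0 < l) (hτ : 0 ≤ τ)
    (hw : 2 * (w + 3 * τ) = σ * l) (hP : (P + 1) * (l * (2 + σ)) + τ ≤ dist x y / 2) (p : E d) :
    ∃ A : Fin P → Cylinder d, IsCylinderColumn σ l w τ x y p A := by
  have hlσ : 0 < l * σ := mul_pos hl hσ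
  have hw0 : 0 < w + 3 * τ := by linarith
  have step_le : l * (2 + σ) ≤ (P + 1) * (l * (2 + σ)) :=
    le_mul_of_one_le_left (by positivity) (le_add_of_nonneg_left P.cast_nonneg)
  have hxy : 0 < dist x y := by linarith
  set e := (dist x y)⁻¹ • (y - x)
  have he : ‖e‖ = 1 := by
    rw [norm_smul, norm_inv, Real.norm_of_nonneg hxy.le, ← dist_eq_norm', inv_mul_cancel₀ hxy.ne']
  obtain ⟨o, ho⟩ := exists_heights (l := l) (by linarith) (by positivity) hP
    (inner ℝ e (p - x))
  let A : Fin P → Cylinder d := fun j =>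
    axisCylinder x e (o + j * (l * (2 + σ))) l (w + 3 * τ) he hl hw0
  have le_dist_of_lt {j j' : Fin P} (hj : j < j') {z z' : E d} (hz : z ∈ (A j).carrier)
      (hz' : z' ∈ (A j').carrier) : l * (1 + σ) ≤ dist z' z := by
    have height_z := (mem_carrier_axisCylinder.1 hz).1.2
    have height_z' := (mem_carrier_axisCylinder.1 hz').1.1
    have : ((j : ℝ) + 1) * (l * (2 + σ)) ≤ j' * (l * (2 + σ)) :=
      mul_le_mul_of_nonneg_right (by exact_mod_cast hj) (by positivity)
    linarith [(abs_le.1 (abs_inner_sub_inner_le_dist he x z' z)).2]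
  refine ⟨A, fun _ => length_axisCylinder, fun _ => hw,
    fun j => ediam_carrier_axisCylinder_le.trans_eq (by congr 1; linarith),
    fun j j' hj z hz z' hz' => ?_, fun j z hz => ?_, fun j z hz => ?_,
    fun j F a b hF hseg hst hx hy => hseg.crosses_axisCylinder hF hst hx hy (ho j).1 (ho j).2.1⟩
  · rcases lt_or_gt_of_ne hj with h | h
    · rw [dist_comm]
      exact le_dist_of_lt h hz hz'
    · exact le_dist_of_lt h hz' hz
  · obtain ⟨height_z, hz⟩ := mem_carrier_axisCylinder.1 hz
    have abs_height_le : |inner ℝ e (z - x)| ≤ dist x y :=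
      abs_le.2 ⟨by linarith [height_z.1, (ho j).1], by linarith [height_z.2, (ho j).2.1]⟩
    linarith [dist_le_abs_inner_add_lineDist he x z]
  · exact ((ho j).2.2 _ (mem_carrier_axisCylinder.1 hz).1).trans
      (abs_inner_sub_inner_le_dist he x p z)

theorem wellSeparated_of_isCylinderColumn {ι κ : Type*} [LinearOrder ι] {l w τ : ι → ℝ}
    {x y p : ι → E d} {A : ι → κ → Cylinder d} (hσ : 0 ≤ σ)
    (hA : ∀ i, IsCylinderColumn σ (l i) (w i) (τ i) (x i) (y i) (p i) (A i)) (hl : Antitone l)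
    (h : ∀ i i', i < i' → 2 * dist (x i') (y i') + dist (p i) (x i') ≤ l i) :
    WellSeparated fun j : ι × κ => (A j.1 j.2).carrier := by
  have le_dist_of_lt {i i' : ι} (hi : i < i') (j j' : κ) {z z' : E d}
      (hz : z ∈ (A i j).carrier) (hz' : z' ∈ (A i' j').carrier) : l i * (1 + σ) ≤ dist z z' := by
    have := dist_triangle4 (p i) (x i') z' z
    rw [dist_comm (x i') z', dist_comm z' z] at this
    linarith [(hA i).le_dist_avoided j z hz, (hA i').dist_le j' z' hz', h i i' hi]
  rintro ⟨i, j⟩ ⟨i', j'⟩ hne z hz z' hz'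
  refine ((hA i).ediam_le j).trans ?_
  rw [edist_dist]
  refine ENNReal.ofReal_le_ofReal ?_
  rcases lt_trichotomy i i' with hi | rfl | hi
  · exact le_dist_of_lt hi j j' hz hz'
  · exact (hA i).le_dist (fun hj => hne (Prod.ext rfl hj)) z hz z' hz'
  · rw [dist_comm]
    exact (mul_le_mul_of_nonneg_right (hl hi.le) (by linarith)).trans
      (le_dist_of_lt hi j' j hz' hz)

end Column

section Chain

variable {X : Type*} [PseudoMetricSpace X] {F : ℝ → X} {L : ℕ → ℝ} {k : ℕ} {a b : ℕ → ℝ}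

namespace IsSegmentChain

theorem Icc_subset_Icc (h : IsSegmentChain F L k a b) {i j : ℕ} (hij : i ≤ j) (hj : j ≤ k) :
    Set.Icc (a j) (b j) ⊆ Set.Icc (a i) (b i) := by
  induction j, hij using Nat.le_induction with
  | base => exact subset_rfl
  | succ j _ ih =>
    exact (Set.Icc_subset_Icc (h.left_le_left j hj) (h.right_le_right j hj)).trans
      (ih (Nat.le_of_succ_le hj))

theorem Icc_subset_Icc_zero_one (h : IsSegmentChain F L k a b) {i : ℕ} (hi : i ≤ k) :
    Set.Icc (a i) (b i) ⊆ Set.Icc 0 1 :=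
  (h.Icc_subset_Icc i.zero_le hi).trans (Set.Icc_subset_Icc h.zero_le h.le_one)

theorem dist_left_le (h : IsSegmentChain F L k a b) {i j : ℕ} (hij : i ≤ j) (hj : j ≤ k) :
    dist (F (a i)) (F (a j)) ≤ L i :=
  (h.isSegment i (hij.trans hj)).dist_le _
    (h.Icc_subset_Icc hij hj ⟨le_rfl, (h.isSegment j hj).le⟩)

theorem dist_right_le (h : IsSegmentChain F L k a b) {i j : ℕ} (hij : i ≤ j) (hj : j ≤ k) :
    dist (F (b i)) (F (b j)) ≤ 2 * L i := by
  have hseg := h.isSegment i (hij.trans hj)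
  refine (dist_triangle_left _ _ (F (a i))).trans ?_
  rw [two_mul]
  exact add_le_add hseg.dist_eq.le
    (hseg.dist_le _ (h.Icc_subset_Icc hij hj ⟨(h.isSegment j hj).le, le_rfl⟩))

end IsSegmentChain

end Chain

section Family

variable {d : ℕ} {σ r : ℝ} {q P : ℕ}

theorem scale_antitone (hr : 0 ≤ r) (hq : 2 ≤ q) : Antitone (scale r q) := fun _ _ hij =>
  div_le_div_of_nonneg_left hr (pow_pos (scaleRatio_pos hq) _)
    (pow_le_pow_right₀ (one_lt_scaleRatio hq).le hij)

/-- The length for which a cylinder of aspect ratio `σ` around a segment of size `L` contains all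
paths that are straight up to the error `2 L / q` and start and end near this segment. -/
def cylinderLength (σ L : ℝ) (q : ℕ) : ℝ := 6 * L / (q * σ)

/-- `P` cylinders of this length can be placed along one half of each segment, away from a given
point. -/
def HasRoomForCylinders (σ : ℝ) (q P : ℕ) : Prop :=
  (P + 1) * (cylinderLength σ 1 q * (2 + σ)) + 1 / (3 * q) ≤ 1 / 2

theorem three_mul_scale_succ_le_cylinderLength (hr : 0 < r) (hq : 2 ≤ q) (hσ : 0 < σ)
    (hσq : σ ≤ q) (i : ℕ) : 3 * scale r q (i + 1) ≤ cylinderLength σ (scale r q i) q := by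
  have hq1 : (1 : ℝ) ≤ q := by exact_mod_cast (by omega : 1 ≤ q)
  have := scale_pos hr hq i
  have mul_le : q * σ ≤ 2 * scaleRatio q := calc
    q * σ ≤ q * q := by gcongr
    _ = (q : ℝ) ^ 2 := (sq _).symm
    _ ≤ q ^ 4 := pow_le_pow_right₀ hq1 (by norm_num)
    _ ≤ 2 * scaleRatio q := by
      rw [scaleRatio]
      linarith [show (0 : ℝ) ≤ (q : ℝ) ^ 4 by positivity]
  rw [scale_succ, cylinderLength, ← mul_div_assoc,
    div_le_div_iff₀ (scaleRatio_pos hq) (by positivity)]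
  linarith [mul_le_mul_of_nonneg_left mul_le this.le]

theorem IsSegmentChain.exists_wellSeparated_cylinders {F : ℝ → E d} {k : ℕ} {a b : ℕ → ℝ}
    (h : IsSegmentChain F (scale r q) k a b) (hr : 0 < r) (hq : 2 ≤ q) (hσ : 0 < σ)
    (hσq : σ ≤ q) (hP : HasRoomForCylinders σ q P) {J : Finset ℕ} (hJ : J ⊆ Finset.range k) :
    ∃ A : J × Fin P → Cylinder d, WellSeparated (fun j => (A j).carrier) ∧
      (∀ j, (A j).width = σ * (A j).length) ∧
      (∀ j, (A j).length = cylinderLength σ (scale r q j.1) q) ∧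
      ∀ (i : J) (j : Fin P) {G : ℝ → E d} {u v : ℝ}, Continuous G →
        IsSegment G (scale r q i) u v → IsStraight G (2 * scale r q i / q) u v →
        dist (G u) (F (a i)) ≤ scale r q i / (3 * q) →
        dist (G v) (F (b i)) ≤ scale r q i / (3 * q) → Crosses G u v (A (i, j)) := by
  have : (0 : ℝ) < q := by exact_mod_cast (by omega : 0 < q)
  have hJk (i : J) : (i : ℕ) < k := Finset.mem_range.1 (hJ i.2)
  have dist_eq (i : J) : dist (F (a i)) (F (b i)) = scale r q i :=
    (h.isSegment i (hJk i).le).dist_eq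
  have exists_column (i : J) : ∃ A : Fin P → Cylinder d,
      IsCylinderColumn σ (cylinderLength σ (scale r q i) q) (2 * scale r q i / q)
        (scale r q i / (3 * q)) (F (a i)) (F (b i)) (F (a (i + 1))) A := by
    have hL := scale_pos hr hq i
    refine exists_isCylinderColumn hσ (by unfold cylinderLength; positivity) (by positivity)
      (by unfold cylinderLength; field_simp; ring) ?_ _
    calc (P + 1) * (cylinderLength σ (scale r q i) q * (2 + σ)) + scale r q i / (3 * q)
      _ = ((P + 1) * (cylinderLength σ 1 q * (2 + σ)) + 1 / (3 * q)) * scale r q i := by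
        unfold cylinderLength
        ring
      _ ≤ 1 / 2 * scale r q i := mul_le_mul_of_nonneg_right hP hL.le
      _ = dist (F (a i)) (F (b i)) / 2 := by rw [dist_eq, one_div_mul_eq_div]
  choose A hA using exists_column
  refine ⟨fun j => A j.1 j.2, wellSeparated_of_isCylinderColumn hσ.le hA (fun i i' hi => ?_)
    fun i i' hi => ?_, fun j => ?_, fun j => (hA j.1).length_eq j.2, fun i j G u v hG hseg => ?_⟩
  · have := scale_antitone hr.le hq (Subtype.coe_le_coe.2 hi)
    unfold cylinderLength
    gcongr
  · rw [dist_eq]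
    have hsucc : (i : ℕ) + 1 ≤ i' := hi
    have := h.dist_left_le hsucc (hJk i').le
    have := scale_antitone hr.le hq hsucc
    linarith [three_mul_scale_succ_le_cylinderLength hr hq hσ hσq i]
  · rw [(hA j.1).length_eq, (hA j.1).width_eq]
  · exact (hA i).crosses j hG ((dist_eq i).symm ▸ hseg)

end Family

/-! ### Nets of sequences -/

section Net

/-- Doubling `m` times: a ball of radius `2 ^ m * R` is covered by `N ^ m` balls of radius `R`. -/
theorem exists_finset_cover_closedBall (V : Type*) [NormedAddCommGroup V] [NormedSpace ℝ V]
    [ProperSpace V] : ∃ N : ℕ, ∀ (m : ℕ) (x : V) {R : ℝ}, 0 < R → ∃ s : Finset V,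
      s.card ≤ N ^ m ∧ Metric.closedBall x (2 ^ m * R) ⊆ ⋃ y ∈ s, Metric.closedBall y R := by
  classical
  obtain ⟨t, -, ht, cover⟩ := (isCompact_closedBall (0 : V) 2).finite_cover_balls one_pos
  lift t to Finset V using ht
  refine ⟨t.card, fun m => ?_⟩
  induction m with
  | zero => exact fun x R _ => ⟨{x}, by simp⟩
  | succ m ih =>
    intro x R hR
    obtain ⟨s, card_le, hs⟩ := ih x (mul_pos two_pos hR)
    refine ⟨Finset.image₂ (fun y u => y + R • u) s t, (Finset.card_image₂_le _ _ _).trans ?_,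
      fun z hz => ?_⟩
    · rw [pow_succ]
      gcongr
    · rw [pow_succ, mul_assoc] at hz
      obtain ⟨y, hy, hzy⟩ := Set.mem_iUnion₂.1 (hs hz)
      rw [mem_closedBall_iff_norm] at hzy
      obtain ⟨u, hu, hzu⟩ := Set.mem_iUnion₂.1 (cover (show R⁻¹ • (z - y) ∈ _ by
        rwa [mem_closedBall_zero_iff, norm_smul, norm_inv, Real.norm_of_nonneg hR.le,
          inv_mul_le_iff₀ hR, mul_comm]))
      refine Set.mem_iUnion₂.2 ⟨y + R • u, Finset.mem_image₂_of_mem hy hu, ?_⟩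
      rw [mem_ball_iff_norm] at hzu
      rw [mem_closedBall_iff_norm, ← sub_sub, ← smul_inv_smul₀ hR.ne' (z - y), ← smul_sub,
        norm_smul, Real.norm_of_nonneg hR.le]
      exact mul_le_of_le_one_right hR.le hzu.le

theorem exists_finset_sequence_net {X : Type*} [PseudoMetricSpace X] {N : ℕ} {η ρ : ℕ → ℝ}
    {A : Set X} {S : Finset X} (hS : A ⊆ ⋃ y ∈ S, Metric.closedBall y (η 0))
    (step : ∀ i x, ∃ s : Finset X, s.card ≤ N ∧
      Metric.closedBall x (ρ i + η i) ⊆ ⋃ y ∈ s, Metric.closedBall y (η (i + 1))) (k : ℕ) :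
    ∃ t : Finset (ℕ → X), t.card ≤ S.card * N ^ k ∧ ∀ x : ℕ → X, x 0 ∈ A →
      (∀ i < k, dist (x (i + 1)) (x i) ≤ ρ i) → ∃ y ∈ t, ∀ i ≤ k, dist (x i) (y i) ≤ η i := by
  classical
  choose s card_s_le hs using step
  induction k with
  | zero =>
    refine ⟨S.image fun y _ => y, by simpa using Finset.card_image_le, fun x hx _ => ?_⟩
    obtain ⟨y, hy, hxy⟩ := Set.mem_iUnion₂.1 (hS hx)
    exact ⟨_, Finset.mem_image_of_mem _ hy, fun i hi => by rwa [Nat.le_zero.1 hi]⟩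
  | succ k ih =>
    obtain ⟨t, card_le, ht⟩ := ih
    refine ⟨t.biUnion fun y => (s k (y k)).image (Function.update y (k + 1)), ?_,
      fun x hx hxs => ?_⟩
    · rw [pow_succ, ← mul_assoc]
      exact (Finset.card_biUnion_le_card_mul _ _ N fun y _ =>
        Finset.card_image_le.trans (card_s_le k (y k))).trans (Nat.mul_le_mul_right N card_le)
    · obtain ⟨y, hy, hxy⟩ := ht x hx fun i hi => hxs i (Nat.lt_succ_of_lt hi)
      have hmem : x (k + 1) ∈ Metric.closedBall (y k) (ρ k + η k) :=
        (dist_triangle _ (x k) _).trans (add_le_add (hxs k k.lt_succ_self) (hxy k le_rfl))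
      obtain ⟨z, hz, hxz⟩ := Set.mem_iUnion₂.1 (hs k (y k) hmem)
      refine ⟨_, Finset.mem_biUnion.2 ⟨y, hy, Finset.mem_image_of_mem _ hz⟩, fun i hi => ?_⟩
      rcases Nat.le_succ_iff.1 hi with hi | rfl
      · rw [Function.update_of_ne (Nat.lt_succ_of_le hi).ne]
        exact hxy i hi
      · rwa [Function.update_self]

end Net

/-! ### The probability that the straight levels are not sparse -/

section Probability

variable {d : ℕ} {Λ : Set (E d)} {σ ρ K δ r : ℝ} {q p k : ℕ} {m : Measure (Config Λ)}

theorem WellSeparated.comp {ι κ : Type*} {A : ι → Set (E d)} (h : WellSeparated A) {e : κ → ι}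
    (he : Function.Injective e) : WellSeparated (fun i => A (e i)) :=
  fun i j hij => h (e i) (e j) (he.ne hij)

/-- The bound of hypothesis **H2** for a single law `m` of the random configuration, with the
short-distance cutoff `δ`. -/
def HasCrossingBound (σ ρ K δ : ℝ) (m : Measure (Config Λ)) : Prop :=
  ∀ (k : ℕ) (A : Fin k → Cylinder d), WellSeparated (fun j => (A j).carrier) →
    (∀ j, (A j).width = σ * (A j).length) → (∀ j, δ ≤ (A j).length) →
    m.real {F | ∀ j, ∃ C ∈ F, C.Traverses (A j)} ≤ K * ρ ^ k

theorem HasCrossingBound.nonneg (h : HasCrossingBound σ ρ K δ m) : 0 ≤ K := by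
  simpa only [pow_zero, mul_one] using measureReal_nonneg.trans
    (h 0 (fun j => j.elim0) (fun j => j.elim0) (fun j => j.elim0) fun j => j.elim0)

theorem HasCrossingBound.measureReal_le (h : HasCrossingBound σ ρ K δ m) {ι : Type*} [Fintype ι]
    {A : ι → Cylinder d} (hA : WellSeparated fun j => (A j).carrier)
    (width_eq : ∀ j, (A j).width = σ * (A j).length) (le_length : ∀ j, δ ≤ (A j).length) :
    m.real {F | ∀ j, ∃ C ∈ F, C.Traverses (A j)} ≤ K * ρ ^ Fintype.card ι := by
  let e := (Fintype.equivFin ι).symm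
  have := h _ (fun j => A (e j)) (hA.comp e.injective) (fun j => width_eq _) fun j => le_length _
  simpa only [e.forall_congr_left, Equiv.apply_symm_apply] using this

/-- Some curve of the configuration has a chain of depth `k` of which more than half of the levels
are straight. -/
def straightEvent (Λ : Set (E d)) (q : ℕ) (r : ℝ) (k : ℕ) : Set (Config Λ) :=
  {F | ∃ f : ParamCurve Λ, (SeparationQuotient.mk f : Curve Λ) ∈ F ∧ ∃ a b : ℕ → ℝ,
    IsSegmentChain f.path (scale r q) k a b ∧ k < 2 * (straightLevels f.path q k a b).card}

/-- Some curve of the configuration has a chain of depth `k` with end points close to `z` and set of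
straight levels `J`. -/
def nearChainEvent (Λ : Set (E d)) (q : ℕ) (r : ℝ) (k : ℕ) (z : ℕ → E d × E d) (J : Finset ℕ) :
    Set (Config Λ) :=
  {F | ∃ f : ParamCurve Λ, (SeparationQuotient.mk f : Curve Λ) ∈ F ∧ ∃ a b : ℕ → ℝ,
    IsSegmentChain f.path (scale r q) k a b ∧ straightLevels f.path q k a b = J ∧
      ∀ i ≤ k, dist (f.path (a i), f.path (b i)) (z i) ≤ scale r q i / (6 * q)}

/-- All configurations of the event have curves that cross the cylinders along one given chain. -/
theorem HasCrossingBound.measureReal_nearChainEvent_le [IsFiniteMeasure m]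
    (h : HasCrossingBound σ ρ K δ m) (hσ : 0 < σ) (hρ0 : 0 ≤ ρ) (hρ1 : ρ ≤ 1) (hr : 0 < r)
    (hq : 2 ≤ q) (hσq : σ ≤ q) (hP : HasRoomForCylinders σ q (2 * p))
    (hδ : ∀ i < k, δ ≤ cylinderLength σ (scale r q i) q) (z : ℕ → E d × E d) {J : Finset ℕ}
    (hJ : k ≤ 2 * J.card) : m.real (nearChainEvent Λ q r k z J) ≤ K * (ρ ^ p) ^ k := by
  have hK := h.nonneg
  rcases (nearChainEvent Λ q r k z J).eq_empty_or_nonempty with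
    empty | ⟨-, f, -, a, b, chain, levels_eq, near⟩
  · rw [empty, measureReal_empty]
    positivity
  have J_subset : J ⊆ Finset.range k := levels_eq ▸ straightLevels_subset_range
  have hJk {i : ℕ} (hi : i ∈ J) : i < k := Finset.mem_range.1 (J_subset hi)
  obtain ⟨A, separated, width_eq, length_eq, crosses⟩ :=
    chain.exists_wellSeparated_cylinders hr hq hσ hσq hP J_subset
  have event_subset :
      nearChainEvent Λ q r k z J ⊆ {F | ∀ j, ∃ C ∈ F, C.Traverses (A j)} := by
    rintro F ⟨g, hg, u, v, chain', rfl, near'⟩ ⟨⟨i, hi⟩, j⟩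
    have hik : i ≤ k := (hJk hi).le
    have hseg := chain'.isSegment i hik
    have hst : IsStraight g.path (2 * scale r q i / q) (u i) (v i) := by
      rw [← hseg.dist_eq]
      exact (mem_straightLevels.1 hi).2
    have hdist : dist (g.path (u i), g.path (v i)) (f.path (a i), f.path (b i)) ≤
        scale r q i / (3 * q) := calc
      _ ≤ scale r q i / (6 * q) + scale r q i / (6 * q) :=
        (dist_triangle_right _ _ (z i)).trans (add_le_add (near' i hik) (near i hik))
      _ = scale r q i / (3 * q) := by ring
    have subset := chain'.Icc_subset_Icc_zero_one hik
    exact ⟨_, hg, (crosses ⟨i, hi⟩ j g.continuous_path hseg hst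
      ((le_max_left _ _).trans hdist) ((le_max_right _ _).trans hdist)).traverses
      (subset ⟨le_rfl, hseg.le⟩).1 (subset ⟨hseg.le, le_rfl⟩).2⟩
  calc m.real (nearChainEvent Λ q r k z J)
    _ ≤ m.real {F | ∀ j, ∃ C ∈ F, C.Traverses (A j)} := measureReal_mono event_subset
    _ ≤ K * ρ ^ Fintype.card (J × Fin (2 * p)) := h.measureReal_le separated width_eq fun j =>
      (hδ _ (hJk j.1.2)).trans_eq (length_eq j).symm
    _ ≤ K * (ρ ^ p) ^ k := by
      rw [← pow_mul]
      refine mul_le_mul_of_nonneg_left (pow_le_pow_of_le_one hρ0 hρ1 ?_) hK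
      rw [Fintype.card_prod, Fintype.card_coe, Fintype.card_fin]
      linarith [Nat.mul_le_mul_left p hJ]

theorem IsSegmentChain.dist_succ_le {X : Type*} [PseudoMetricSpace X] {F : ℝ → X} {L : ℕ → ℝ}
    {a b : ℕ → ℝ} (h : IsSegmentChain F L k a b) {i : ℕ} (hi : i < k) :
    dist (F (a (i + 1)), F (b (i + 1))) (F (a i), F (b i)) ≤ 2 * L i := by
  have hL : 0 ≤ L i := dist_nonneg.trans (h.isSegment i hi.le).dist_eq.le
  rw [dist_comm]
  exact max_le ((h.dist_left_le i.le_succ hi).trans (by linarith)) (h.dist_right_le i.le_succ hi)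

theorem exists_net_of_segmentChains (hΛ : Bornology.IsBounded Λ) {N n : ℕ}
    (cover : ∀ (x : E d × E d) {R : ℝ}, 0 < R → ∃ s : Finset (E d × E d), s.card ≤ N ∧
      Metric.closedBall x (2 ^ n * R) ⊆ ⋃ y ∈ s, Metric.closedBall y R)
    (hn : 18 * q * scaleRatio q ≤ 2 ^ n) (hr : 0 < r) (hq : 2 ≤ q) :
    ∃ c : ℕ, ∀ k, ∃ t : Finset (ℕ → E d × E d), t.card ≤ c * N ^ k ∧
      ∀ (f : ParamCurve Λ) (a b : ℕ → ℝ), IsSegmentChain f.path (scale r q) k a b →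
        ∃ z ∈ t, ∀ i ≤ k, dist (f.path (a i), f.path (b i)) (z i) ≤ scale r q i / (6 * q) := by
  have hq1 : (1 : ℝ) ≤ q := by exact_mod_cast (by omega : 1 ≤ q)
  have η_pos (i : ℕ) : 0 < scale r q i / (6 * q) := div_pos (scale_pos hr hq i) (by linarith)
  obtain ⟨S, -, hS, S_cover⟩ :=
    (hΛ.prod hΛ).isCompact_closure.finite_cover_balls (η_pos 0)
  lift S to Finset (E d × E d) using hS
  have radius_le (i : ℕ) :
      2 * scale r q i + scale r q i / (6 * q) ≤ 2 ^ n * (scale r q (i + 1) / (6 * q)) := by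
    have hL := (scale_pos hr hq i).le
    have hγ := scaleRatio_pos hq
    calc 2 * scale r q i + scale r q i / (6 * q)
      _ ≤ 2 * scale r q i + scale r q i := by
        gcongr
        exact div_le_self hL (by linarith)
      _ = 18 * q * scaleRatio q * (scale r q (i + 1) / (6 * q)) := by
        rw [scale_succ]
        field_simp
        ring
      _ ≤ _ := mul_le_mul_of_nonneg_right hn (η_pos _).le
  have step (i : ℕ) (x : E d × E d) : ∃ s : Finset (E d × E d), s.card ≤ N ∧
      Metric.closedBall x (2 * scale r q i + scale r q i / (6 * q)) ⊆
        ⋃ y ∈ s, Metric.closedBall y (scale r q (i + 1) / (6 * q)) := by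
    obtain ⟨s, card_le, hs⟩ := cover x (η_pos (i + 1))
    exact ⟨s, card_le, (Metric.closedBall_subset_closedBall (radius_le i)).trans hs⟩
  have S_cover_closed : Λ ×ˢ Λ ⊆ ⋃ y ∈ S, Metric.closedBall y (scale r q 0 / (6 * q)) :=
    (subset_closure.trans S_cover).trans
      (Set.iUnion₂_mono fun _ _ => Metric.ball_subset_closedBall)
  refine ⟨S.card, fun k => ?_⟩
  obtain ⟨t, card_le, ht⟩ := exists_finset_sequence_net
    (η := fun i => scale r q i / (6 * q)) (ρ := fun i => 2 * scale r q i) S_cover_closed step k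
  exact ⟨t, card_le, fun f a b chain => ht (fun i => (f.path (a i), f.path (b i)))
    ⟨Subtype.coe_prop _, Subtype.coe_prop _⟩ fun i hi => chain.dist_succ_le hi⟩

theorem exists_measureReal_straightEvent_le (hΛ : Bornology.IsBounded Λ) {N n : ℕ}
    (cover : ∀ (x : E d × E d) {R : ℝ}, 0 < R → ∃ s : Finset (E d × E d), s.card ≤ N ∧
      Metric.closedBall x (2 ^ n * R) ⊆ ⋃ y ∈ s, Metric.closedBall y R)
    (hn : 18 * q * scaleRatio q ≤ 2 ^ n) (hσ : 0 < σ) (hρ0 : 0 ≤ ρ) (hρ1 : ρ ≤ 1) (hr : 0 < r)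
    (hq : 2 ≤ q) (hσq : σ ≤ q) (hP : HasRoomForCylinders σ q (2 * p)) :
    ∃ c : ℕ, ∀ (m : Measure (Config Λ)) [IsFiniteMeasure m] (δ : ℝ), HasCrossingBound σ ρ K δ m →
      ∀ k, (∀ i < k, δ ≤ cylinderLength σ (scale r q i) q) →
        m.real (straightEvent Λ q r k) ≤ c * K * (2 * N * ρ ^ p) ^ k := by
  obtain ⟨c, hc⟩ := exists_net_of_segmentChains hΛ cover hn hr hq
  refine ⟨c, fun m _ δ h k hδ => ?_⟩
  have hK := h.nonneg
  obtain ⟨t, card_le, ht⟩ := hc k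
  let I := t ×ˢ {J ∈ (Finset.range k).powerset | k ≤ 2 * J.card}
  have event_subset : straightEvent Λ q r k ⊆ ⋃ j ∈ I, nearChainEvent Λ q r k j.1 j.2 := by
    rintro F ⟨f, hf, a, b, chain, hk⟩
    obtain ⟨z, hz, near⟩ := ht f a b chain
    exact Set.mem_iUnion₂.2 ⟨(z, straightLevels f.path q k a b), Finset.mem_product.2 ⟨hz,
      Finset.mem_filter.2 ⟨Finset.mem_powerset.2 straightLevels_subset_range, hk.le⟩⟩,
      f, hf, a, b, chain, rfl, near⟩
  have card_I_le : (I.card : ℝ) ≤ c * N ^ k * 2 ^ k := by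
    rw [Finset.card_product]
    exact_mod_cast Nat.mul_le_mul card_le ((Finset.card_filter_le _ _).trans_eq
      (by rw [Finset.card_powerset, Finset.card_range]))
  calc m.real (straightEvent Λ q r k)
    _ ≤ m.real (⋃ j ∈ I, nearChainEvent Λ q r k j.1 j.2) :=
      measureReal_mono event_subset (measure_ne_top _ _)
    _ ≤ ∑ j ∈ I, m.real (nearChainEvent Λ q r k j.1 j.2) := measureReal_biUnion_finset_le _ _
    _ ≤ I.card • (K * (ρ ^ p) ^ k) := Finset.sum_le_card_nsmul _ _ _ fun j hj =>
      h.measureReal_nearChainEvent_le hσ hρ0 hρ1 hr hq hσq hP hδ j.1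
        (Finset.mem_filter.1 (Finset.mem_product.1 hj).2).2
    _ ≤ c * N ^ k * 2 ^ k * (K * (ρ ^ p) ^ k) := by
      rw [nsmul_eq_mul]
      gcongr
    _ = c * K * (2 * N * ρ ^ p) ^ k := by ring

end Probability

section Parameters

variable {d : ℕ} {Λ : Set (E d)} {σ ρ : ℝ}

theorem hasRoomForCylinders_mul (hσ : 0 < σ) {Q p : ℕ} (hp : 0 < p) (hQ : 40 ≤ Q)
    (hQσ : 40 * (2 + σ) ≤ Q * σ) : HasRoomForCylinders σ (Q * p) (2 * p) := by
  have hp' : (1 : ℝ) ≤ p := by exact_mod_cast hp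
  have hQ' : (40 : ℝ) ≤ Q := by exact_mod_cast hQ
  have hQp : (40 : ℝ) ≤ Q * p := hQ'.trans (le_mul_of_one_le_right (by linarith) hp')
  have cylinders_le : (2 * p + 1) * (cylinderLength σ 1 (Q * p) * (2 + σ)) ≤ 9 / 20 := calc
    _ ≤ 3 * p * (cylinderLength σ 1 (Q * p) * (2 + σ)) := by
      unfold cylinderLength
      gcongr
      linarith
    _ = 18 * (2 + σ) / (Q * σ) := by
      unfold cylinderLength
      push_cast
      field_simp
      norm_num
    _ ≤ 9 / 20 := by
      rw [div_le_div_iff₀ (by positivity) (by norm_num)]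
      linarith
  have margin_le : 1 / (3 * ((Q : ℝ) * p)) ≤ 1 / 120 :=
    one_div_le_one_div_of_le (by norm_num) (by linarith)
  unfold HasRoomForCylinders
  push_cast
  linarith

theorem eighteen_mul_scaleRatio_two_pow_le (e : ℕ) :
    18 * (2 ^ e : ℕ) * scaleRatio (2 ^ e) ≤ 2 ^ (5 * e + 6) := by
  have one_le : (1 : ℝ) ≤ 2 ^ e := one_le_pow₀ one_le_two
  have sq_le : ((2 : ℝ) ^ e) ^ 2 ≤ (2 ^ e) ^ 5 := pow_le_pow_right₀ one_le (by norm_num)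
  unfold scaleRatio
  push_cast
  calc 18 * (2 : ℝ) ^ e * ((2 ^ e) ^ 4 + 2 ^ e)
    _ = 18 * ((2 ^ e) ^ 5 + (2 ^ e) ^ 2) := by ring
    _ ≤ 2 ^ 6 * (2 ^ e) ^ 5 := by linarith [sq_nonneg ((2 : ℝ) ^ e)]
    _ = 2 ^ (5 * e + 6) := by ring

/-- The number `N ^ n` of points of the net grows only polynomially in `p`. -/
theorem exists_parameters (N : ℕ) (hσ : 0 < σ) (hρ0 : 0 ≤ ρ) (hρ1 : ρ < 1) :
    ∃ q p n : ℕ, 3 ≤ q ∧ σ ≤ q ∧ HasRoomForCylinders σ q (2 * p) ∧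
      18 * q * scaleRatio q ≤ 2 ^ n ∧ 2 * (N ^ n : ℕ) * ρ ^ p ≤ 1 / 2 := by
  obtain ⟨e, he⟩ := pow_unbounded_of_one_lt (40 + 80 / σ + σ) one_lt_two
  obtain ⟨g, hg⟩ : ∃ g, N ^ 5 ≤ 2 ^ g := ⟨N ^ 5, Nat.lt_two_pow_self.le⟩
  have tendsto_zero : Tendsto (fun p : ℕ => 2 * (N : ℝ) ^ (5 * e + 6) * ((p : ℝ) ^ g * ρ ^ p))
      atTop (𝓝 0) := by
    simpa only [mul_zero] using (tendsto_pow_const_mul_const_pow_of_abs_lt_one g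
      (by rwa [abs_of_nonneg hρ0])).const_mul (2 * (N : ℝ) ^ (5 * e + 6))
  obtain ⟨j, hj⟩ := ((tendsto_zero.comp (tendsto_pow_atTop_atTop_of_one_lt one_lt_two)).eventually
    (gt_mem_nhds one_half_pos)).exists
  have : 0 < 80 / σ := by positivity
  have forty_le : 40 ≤ 2 ^ e := by exact_mod_cast (by linarith : (40 : ℝ) ≤ 2 ^ e)
  have forty_mul_le : 40 * (2 + σ) ≤ ((2 ^ e : ℕ) : ℝ) * σ := calc
    40 * (2 + σ) ≤ (40 + 80 / σ + σ) * σ := by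
      field_simp
      linarith [mul_pos hσ hσ]
    _ ≤ ((2 ^ e : ℕ) : ℝ) * σ := by
      push_cast
      exact mul_le_mul_of_nonneg_right he.le hσ.le
  have le_q : 2 ^ e ≤ 2 ^ e * 2 ^ j := Nat.le_mul_of_pos_right _ (by positivity)
  refine ⟨2 ^ e * 2 ^ j, 2 ^ j, 5 * (e + j) + 6, by omega, ?_,
    hasRoomForCylinders_mul hσ (by positivity) forty_le forty_mul_le, ?_, ?_⟩
  · calc σ ≤ 2 ^ e := by linarith
      _ ≤ ((2 ^ e * 2 ^ j : ℕ) : ℝ) := by exact_mod_cast le_q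
  · rw [← pow_add]
    exact eighteen_mul_scaleRatio_two_pow_le _
  · calc 2 * ((N ^ (5 * (e + j) + 6) : ℕ) : ℝ) * ρ ^ 2 ^ j
      _ = 2 * (N : ℝ) ^ (5 * e + 6) * (((N ^ 5 : ℕ) : ℝ) ^ j * ρ ^ 2 ^ j) := by
        push_cast
        ring
      _ ≤ 2 * (N : ℝ) ^ (5 * e + 6) * (((2 ^ g : ℕ) : ℝ) ^ j * ρ ^ 2 ^ j) := by gcongr
      _ = 2 * (N : ℝ) ^ (5 * e + 6) * (((2 ^ j : ℕ) : ℝ) ^ g * ρ ^ 2 ^ j) := by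
        push_cast
        rw [← pow_mul, ← pow_mul, mul_comm g]
      _ ≤ 1 / 2 := hj.le

theorem HypothesisH2.exists_measureReal_straightEvent_le (hΛ : Bornology.IsBounded Λ) {δmax : ℝ}
    {μ : Set.Ioc 0 δmax → ProbabilityMeasure (Config Λ)} (hμ : HypothesisH2 μ) :
    ∃ (q : ℕ) (A : ℝ), 3 ≤ q ∧ 0 < A ∧ ∀ r > 0, ∃ c ≥ 0, ∀ (δ : Set.Ioc 0 δmax) (k : ℕ),
      (∀ i < k, δ ≤ A * scale r q i) →
        (μ δ : Measure (Config Λ)).real (straightEvent Λ q r k) ≤ c * (1 / 2) ^ k := by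
  obtain ⟨σ, ρ, K, hσ, hρ0, hρ1, H⟩ := hμ
  obtain ⟨N, cover⟩ := exists_finset_cover_closedBall (E d × E d)
  obtain ⟨q, p, n, hq, hσq, hP, hn, decay⟩ := exists_parameters N hσ hρ0 hρ1
  have hq2 : 2 ≤ q := Nat.le_of_succ_le hq
  refine ⟨q, cylinderLength σ 1 q, hq, by unfold cylinderLength; positivity, fun r hr => ?_⟩
  obtain ⟨c, hc⟩ := RandomCurves.exists_measureReal_straightEvent_le (K := K) hΛ (cover n) hn hσ
    hρ0 hρ1.le hr hq2 hσq hP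
  refine ⟨c * |K|, by positivity, fun δ k hδ => ?_⟩
  calc (μ δ : Measure (Config Λ)).real (straightEvent Λ q r k)
    _ ≤ c * K * (2 * (N ^ n : ℕ) * ρ ^ p) ^ k := hc _ δ (H δ) k fun i hi =>
      (hδ i hi).trans_eq (by unfold cylinderLength; ring)
    _ ≤ c * |K| * (1 / 2) ^ k := by
      gcongr
      exact le_abs_self K

end Parameters

/-! ### Capacities are stochastically bounded away from zero -/

section Capacity

variable {d : ℕ} {Λ : Set (E d)}

theorem ParamCurve.image_path (f : ParamCurve Λ) :
    f.path '' Set.Icc 0 1 = Curve.trace (SeparationQuotient.mk f : Curve Λ) := by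
  rw [Curve.trace_mk]
  ext x
  constructor
  · rintro ⟨t, -, rfl⟩
    exact ⟨_, rfl⟩
  · rintro ⟨t, rfl⟩
    exact ⟨t, t.2, f.path_coe t⟩

theorem Curve.isCompact_trace (C : Curve Λ) : IsCompact C.trace := by
  obtain ⟨f, rfl⟩ := SeparationQuotient.surjective_mk C
  rw [Curve.trace_mk]
  exact isCompact_range f.continuous_eval

theorem ParamCurve.exists_diam_le_dist_path (f : ParamCurve Λ) :
    ∃ a b : ℝ, 0 ≤ a ∧ a ≤ b ∧ b ≤ 1 ∧
      Curve.diam (SeparationQuotient.mk f : Curve Λ) ≤ dist (f.path a) (f.path b) := by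
  have continuous_dist : Continuous fun p : ℝ × ℝ => dist (f.path p.1) (f.path p.2) :=
    (f.continuous_path.comp continuous_fst).dist (f.continuous_path.comp continuous_snd)
  obtain ⟨⟨a, b⟩, ⟨ha, hb⟩, hmax⟩ :=
    ((isCompact_Icc (a := (0 : ℝ)) (b := 1)).prod isCompact_Icc).exists_isMaxOn
      ((Set.nonempty_Icc.2 zero_le_one).prod (Set.nonempty_Icc.2 zero_le_one))
      continuous_dist.continuousOn
  have dist_le : ∀ s ∈ Set.Icc (0 : ℝ) 1, ∀ t ∈ Set.Icc (0 : ℝ) 1,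
      dist (f.path s) (f.path t) ≤ dist (f.path a) (f.path b) :=
    fun s hs t ht => isMaxOn_iff.1 hmax (s, t) ⟨hs, ht⟩
  have diam_le : Curve.diam (SeparationQuotient.mk f : Curve Λ) ≤ dist (f.path a) (f.path b) := by
    rw [Curve.diam, ← f.image_path]
    refine Metric.diam_le_of_forall_dist_le dist_nonneg ?_
    rintro _ ⟨s, hs, rfl⟩ _ ⟨t, ht, rfl⟩
    exact dist_le s hs t ht
  rcases le_total a b with hab | hab
  · exact ⟨a, b, ha.1, hab, hb.2, diam_le⟩
  · exact ⟨b, a, hb.1, hab, ha.2, by rwa [dist_comm]⟩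

theorem inv_minCapacity_le {s r δ : ℝ} {F : Config Λ} {u : ℝ≥0∞}
    (h : ∀ C ∈ F, r ≤ C.diam → ∃ ν : ProbabilityMeasure (E d),
      (ν : Measure (E d)) C.traceᶜ = 0 ∧ energy s δ ν ≤ u) : (minCapacity s r δ F)⁻¹ ≤ u := by
  rw [ENNReal.inv_le_iff_inv_le, minCapacity]
  refine le_iInf fun C => le_iInf fun hC => le_iInf fun hr => ENNReal.inv_le_inv.2 ?_
  obtain ⟨ν, hν, energy_le⟩ := h C hC hr
  exact (iInf₂_le ν hν).trans energy_le

theorem exists_inv_minCapacity_le (Λ : Set (E d)) {q : ℕ} (hq : 3 ≤ q) {s : ℝ} (hs : 0 ≤ s)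
    (hsd : s < roughDim q) {r A : ℝ} (hr : 0 < r) (hA : 0 < A) (k₀ : ℕ) :
    ∃ u : ℝ≥0, ∀ (F : Config Λ) (δ : ℝ) (n : ℕ), scale r q n ≤ A * δ →
      (∀ k, k₀ ≤ k → k ≤ n → F ∉ straightEvent Λ q r k) → (minCapacity s r δ F)⁻¹ ≤ u := by
  obtain ⟨u, hu⟩ := exists_energy_le_of_hasSparseStraightLevels (d := d) hq hs hsd hr hA k₀
  refine ⟨u, fun F δ n hn not_mem => inv_minCapacity_le fun C hC hCr => ?_⟩
  obtain ⟨f, rfl⟩ := SeparationQuotient.surjective_mk C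
  obtain ⟨a, b, ha, hab, hb, diam_le⟩ := f.exists_diam_le_dist_path
  have sparse : HasSparseStraightLevels f.path q r k₀ n := fun k hk hkn a b chain =>
    not_lt.1 fun hlt => not_mem k hk hkn ⟨f, hC, a, b, chain, hlt⟩
  rw [← f.image_path]
  exact hu f.path δ n f.continuous_path hn sparse a b ha hab hb (hCr.trans diam_le)

theorem tendsto_scale_atTop {q : ℕ} (hq : 2 ≤ q) (r : ℝ) :
    Tendsto (scale r q) atTop (𝓝 0) :=
  tendsto_const_nhds.div_atTop (tendsto_pow_atTop_atTop_of_one_lt (one_lt_scaleRatio hq))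

theorem measureReal_biUnion_Ico_le_geometric {Ω : Type*} [MeasurableSpace Ω] {m : Measure Ω}
    {S : ℕ → Set Ω} {c : ℝ} (hc : 0 ≤ c) {k₀ n : ℕ}
    (hS : ∀ k ∈ Finset.Ico k₀ n, m.real (S k) ≤ c * (1 / 2) ^ k) :
    m.real (⋃ k ∈ Finset.Ico k₀ n, S k) ≤ c * 2 * (1 / 2) ^ k₀ := calc
  _ ≤ ∑ k ∈ Finset.Ico k₀ n, m.real (S k) := measureReal_biUnion_finset_le _ _
  _ ≤ ∑ k ∈ Finset.Ico k₀ n, c * (1 / 2) ^ k := Finset.sum_le_sum hS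
  _ ≤ c * ((1 / 2) ^ k₀ / (1 - 1 / 2)) := by
    rw [← Finset.mul_sum]
    exact mul_le_mul_of_nonneg_left
      (geom_sum_Ico_le_of_lt_one (by norm_num) (by norm_num)) hc
  _ = c * 2 * (1 / 2) ^ k₀ := by ring

theorem stochasticallyBoundedAwayFromZero_minCapacity {δmax : ℝ}
    {μ : Set.Ioc 0 δmax → ProbabilityMeasure (Config Λ)} {q : ℕ} (hq : 3 ≤ q) {r A c : ℝ}
    (hr : 0 < r) (hA : 0 < A) (hc : 0 ≤ c)
    (rare : ∀ (δ : Set.Ioc 0 δmax) (k : ℕ), (∀ i < k, δ ≤ A * scale r q i) →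
      (μ δ : Measure (Config Λ)).real (straightEvent Λ q r k) ≤ c * (1 / 2) ^ k)
    {s : ℝ} (hs : 0 ≤ s) (hsd : s < roughDim q) :
    StochasticallyBoundedAwayFromZero μ fun δ F => minCapacity s r (δ : ℝ) F := by
  classical
  intro ε hε
  have tendsto_zero : Tendsto (fun k : ℕ => c * 2 * (1 / 2 : ℝ) ^ k) atTop (𝓝 0) := by
    simpa only [mul_zero] using (tendsto_pow_atTop_nhds_zero_of_lt_one one_half_pos.le
      one_half_lt_one).const_mul (c * 2)
  obtain ⟨k₀, hk₀⟩ := (tendsto_zero.eventually_lt_const hε).exists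
  obtain ⟨u, hu⟩ := exists_inv_minCapacity_le Λ hq hs hsd hr (inv_pos.2 hA) k₀
  refine ⟨u + 1, fun δ => ?_⟩
  have exists_scale_lt : ∃ n, scale r q n < A⁻¹ * δ :=
    ((tendsto_scale_atTop (Nat.le_of_succ_le hq) r).eventually_lt_const
      (mul_pos (inv_pos.2 hA) δ.2.1)).exists
  set n := Nat.find exists_scale_lt
  have le_scale {i : ℕ} (hi : i < n) : δ ≤ A * scale r q i :=
    (inv_mul_le_iff₀ hA).1 (not_lt.1 (Nat.find_min exists_scale_lt hi))
  have event_subset : {F : Config Λ | ((u + 1 : ℝ≥0) : ℝ≥0∞) ≤ (minCapacity s r (δ : ℝ) F)⁻¹} ⊆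
      ⋃ k ∈ Finset.Ico k₀ (n + 1), straightEvent Λ q r k := by
    intro F hF
    by_contra not_mem
    have inv_le := hu F δ n (Nat.find_spec exists_scale_lt).le fun k hk hkn hFk =>
      not_mem (Set.mem_biUnion (Finset.mem_Ico.2 ⟨hk, Nat.lt_succ_of_le hkn⟩) hFk)
    exact (lt_add_one u).not_ge (ENNReal.coe_le_coe.1 (le_trans hF inv_le))
  calc (μ δ : Measure (Config Λ)).real _
    _ ≤ (μ δ : Measure (Config Λ)).real (⋃ k ∈ Finset.Ico k₀ (n + 1), straightEvent Λ q r k) :=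
      measureReal_mono event_subset (measure_ne_top _ _)
    _ ≤ c * 2 * (1 / 2) ^ k₀ := measureReal_biUnion_Ico_le_geometric hc fun k hk =>
      rare δ k fun i hi => le_scale (hi.trans_le (Nat.le_of_lt_succ (Finset.mem_Ico.1 hk).2))
    _ ≤ ε := hk₀.le

end Capacity

/-! ### Semicontinuity of the capacity -/

section MinEnergy

variable {d : ℕ} {Λ : Set (E d)}

/-- The infimum of the energies of the probability measures supported on `A`, i.e. the inverse of
the capacity. -/
def minEnergy (s ℓ : ℝ) (A : Set (E d)) : ℝ≥0∞ :=
  ⨅ (ν : ProbabilityMeasure (E d)) (_ : (ν : Measure (E d)) Aᶜ = 0), energy s ℓ ν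

theorem inv_capacity (s ℓ : ℝ) (A : Set (E d)) : (capacity s ℓ A)⁻¹ = minEnergy s ℓ A :=
  inv_inv _

theorem minEnergy_anti {s : ℝ} (hs : 0 ≤ s) {ℓ ℓ' : ℝ} (h : ℓ ≤ ℓ') (A : Set (E d)) :
    minEnergy s ℓ' A ≤ minEnergy s ℓ A :=
  iInf₂_mono fun _ _ => lintegral_mono fun _ => lintegral_mono fun _ =>
    rpow_neg_le_rpow_neg hs (max_le_max le_rfl (ENNReal.ofReal_le_ofReal h))

theorem exists_measurable_projection {X : Type*} [PseudoMetricSpace X] [SeparableSpace X]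
    [MeasurableSpace X] [OpensMeasurableSpace X] {K : Set X} (hK : K.Nonempty) (ε : ℝ) :
    ∃ π : X → X, Measurable π ∧ (∀ x, π x ∈ K) ∧ ∀ x ∈ Metric.thickening ε K, dist x (π x) < ε := by
  classical
  have : Nonempty K := hK.to_subtype
  have : SecondCountableTopology X := UniformSpace.secondCountable_of_separable X
  let e : ℕ → X := fun n => (denseSeq K n : K)
  let p : X → ℕ → Prop := fun x n => dist x (e n) < ε ∨ ∀ m, ε ≤ dist x (e m)
  have exists_p (x : X) : ∃ n, p x n := by
    by_cases h : ∃ n, dist x (e n) < ε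
    · exact h.imp fun n hn => Or.inl hn
    · push Not at h
      exact ⟨0, Or.inr h⟩
  have measurableSet_p (n : ℕ) : MeasurableSet {x | p x n} := by
    have near : MeasurableSet {x | dist x (e n) < ε} :=
      (isOpen_lt (by fun_prop) continuous_const).measurableSet
    have far : MeasurableSet {x | ∀ m, ε ≤ dist x (e m)} := by
      rw [Set.ofPred_forall]
      exact MeasurableSet.iInter fun m =>
        (isClosed_le continuous_const (by fun_prop)).measurableSet
    exact near.union far
  refine ⟨fun x => e (Nat.find (exists_p x)),
    (measurable_from_nat (f := e)).comp (measurable_find exists_p measurableSet_p),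
    fun x => (denseSeq K _ : K).2, fun x hx => ?_⟩
  obtain ⟨y, hy, dist_lt⟩ := Metric.mem_thickening_iff.1 hx
  refine (Nat.find_spec (exists_p x)).resolve_right fun far => ?_
  obtain ⟨n, hn⟩ := (denseRange_denseSeq K).exists_dist_lt ⟨y, hy⟩ (sub_pos.2 dist_lt)
  have : dist y (e n) < ε - dist x y := hn
  linarith [far n, dist_triangle x y (e n)]

theorem energy_map (s ℓ : ℝ) (ν : ProbabilityMeasure (E d)) {π : E d → E d} (hπ : Measurable π) :
    energy s ℓ (ν.map hπ.aemeasurable) = ∫⁻ x, ∫⁻ y,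
      (max (edist (π x) (π y)) (ENNReal.ofReal ℓ)) ^ (-s) ∂(ν : Measure (E d))
        ∂(ν : Measure (E d)) := by
  have measurable_kernel := measurable_energyKernel (d := d) s ℓ
  rw [energy, ProbabilityMeasure.toMeasure_map,
    lintegral_map measurable_kernel.lintegral_prod_right' hπ]
  exact lintegral_congr fun x =>
    lintegral_map (measurable_kernel.comp (measurable_prodMk_left (x := π x))) hπ

theorem one_sub_div_mul_max_le {η ℓ a b : ℝ} (hη : 0 ≤ η) (hℓ : 0 < ℓ) (h : a ≤ b + η) :
    (1 - η / ℓ) * max a ℓ ≤ max b ℓ := by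
  have le_div_mul : η ≤ η / ℓ * max a ℓ := by
    rw [div_mul_eq_mul_div, le_div_iff₀ hℓ]
    exact mul_le_mul_of_nonneg_left (le_max_right a ℓ) hη
  calc (1 - η / ℓ) * max a ℓ ≤ max a ℓ - η := by linarith
    _ ≤ max b ℓ := sub_le_iff_le_add.2 <| max_le
      (h.trans (add_le_add_left (le_max_left b ℓ) η))
      ((le_max_right b ℓ).trans (le_add_of_nonneg_right hη))

theorem energy_map_le {s ℓ ε : ℝ} (hs : 0 ≤ s) (hℓ : 0 < ℓ) (hε : 0 ≤ ε) (hεℓ : 2 * ε < ℓ)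
    (ν : ProbabilityMeasure (E d)) {π : E d → E d} (hπ : Measurable π)
    (h : ∀ᵐ x ∂(ν : Measure (E d)), dist x (π x) ≤ ε) :
    energy s ℓ (ν.map hπ.aemeasurable) ≤
      ENNReal.ofReal ((1 - 2 * ε / ℓ) ^ (-s)) * energy s ℓ ν := by
  have factor_pos : 0 < 1 - 2 * ε / ℓ := by rwa [sub_pos, div_lt_one hℓ]
  rw [energy_map s ℓ ν hπ, energy, ← lintegral_const_mul' _ _ ENNReal.ofReal_ne_top]
  refine lintegral_mono_ae ?_
  filter_upwards [h] with x hx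
  rw [← lintegral_const_mul' _ _ ENNReal.ofReal_ne_top]
  refine lintegral_mono_ae ?_
  filter_upwards [h] with y hy
  have dist_le : dist x y ≤ dist (π x) (π y) + 2 * ε := by
    linarith [dist_triangle4 x (π x) (π y) y, dist_comm y (π y)]
  rw [edist_dist, edist_dist, ← ENNReal.ofReal_max, ← ENNReal.ofReal_max,
    ← ENNReal.ofReal_rpow_of_pos factor_pos,
    ← ENNReal.mul_rpow_of_ne_top ENNReal.ofReal_ne_top ENNReal.ofReal_ne_top,
    ← ENNReal.ofReal_mul factor_pos.le]
  exact rpow_neg_le_rpow_neg hs (ENNReal.ofReal_le_ofReal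
    (one_sub_div_mul_max_le (mul_nonneg zero_le_two hε) hℓ dist_le))

theorem minEnergy_le_of_subset_thickening {s ℓ ε : ℝ} (hs : 0 ≤ s) (hℓ : 0 < ℓ) (hε : 0 ≤ ε)
    (hεℓ : 2 * ε < ℓ) {K K' : Set (E d)} (measurableSet_K : MeasurableSet K) (hK : K.Nonempty)
    (h : K' ⊆ Metric.thickening ε K) :
    minEnergy s ℓ K ≤ ENNReal.ofReal ((1 - 2 * ε / ℓ) ^ (-s)) * minEnergy s ℓ K' := by
  have factor_pos : 0 < (1 - 2 * ε / ℓ) ^ (-s) :=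
    Real.rpow_pos_of_pos (by rwa [sub_pos, div_lt_one hℓ]) _
  obtain ⟨π, hπ, π_mem, dist_lt⟩ := exists_measurable_projection hK ε
  conv_rhs => simp only [minEnergy,
    ENNReal.mul_iInf_of_ne (ENNReal.ofReal_pos.2 factor_pos).ne' ENNReal.ofReal_ne_top]
  refine le_iInf₂ fun ν hν => ?_
  have map_compl : ((ν.map hπ.aemeasurable : ProbabilityMeasure (E d)) : Measure (E d)) Kᶜ = 0 := by
    rw [ProbabilityMeasure.toMeasure_map, Measure.map_apply hπ measurableSet_K.compl,
      Set.preimage_compl, Set.preimage_eq_univ_iff.2 (Set.range_subset_iff.2 π_mem),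
      Set.compl_univ, measure_empty]
  refine (iInf₂_le (ν.map hπ.aemeasurable) map_compl).trans (energy_map_le hs hℓ hε hεℓ ν hπ ?_)
  filter_upwards [show ∀ᵐ x ∂(ν : Measure (E d)), x ∈ K' from hν] with x hx
  exact (dist_lt x (h hx)).le

theorem Curve.trace_subset_thickening {C C' : Curve Λ} {ε : ℝ} (h : dist C C' < ε) :
    C.trace ⊆ Metric.thickening ε C'.trace := by
  obtain ⟨f, rfl⟩ := SeparationQuotient.surjective_mk C
  obtain ⟨g, rfl⟩ := SeparationQuotient.surjective_mk C'
  rw [trace_mk, trace_mk]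
  rintro _ ⟨t, rfl⟩
  rw [SeparationQuotient.dist_mk] at h
  obtain ⟨φ, ψ, dist_lt⟩ := ParamCurve.exists_reparam_lt h
  refine Metric.mem_thickening_iff.2 ⟨g.eval (ψ (φ.symm t)), ⟨_, rfl⟩, lt_of_le_of_lt ?_ dist_lt⟩
  have eval_eq : f.reparam φ (φ.symm t) = (show C(I, Λ) from f) t :=
    congrArg (show C(I, Λ) from f) (φ.apply_symm_apply t)
  have := ContinuousMap.dist_apply_le_dist (f := f.reparam φ) (g := g.reparam ψ) (φ.symm t)
  rwa [eval_eq] at this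

theorem Curve.trace_nonempty (C : Curve Λ) : C.trace.Nonempty := by
  obtain ⟨f, rfl⟩ := SeparationQuotient.surjective_mk C
  rw [trace_mk]
  exact Set.range_nonempty _

theorem Curve.lipschitzWith_diam : LipschitzWith 2 (Curve.diam : Curve Λ → ℝ) := by
  refine LipschitzWith.of_le_add_mul _ fun C C' => ?_
  refine Metric.diam_le_of_forall_dist_le (add_nonneg Metric.diam_nonneg (by positivity)) ?_
  refine fun x hx y hy => le_of_forall_pos_le_add fun ε hε => ?_
  have near := Curve.trace_subset_thickening (lt_add_of_pos_right (dist C C') (half_pos hε))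
  obtain ⟨x', hx', dist_x⟩ := Metric.mem_thickening_iff.1 (near hx)
  obtain ⟨y', hy', dist_y⟩ := Metric.mem_thickening_iff.1 (near hy)
  have dist_le : dist x' y' ≤ C'.diam :=
    Metric.dist_le_diam_of_mem C'.isCompact_trace.isBounded hx' hy'
  push_cast
  linarith [dist_triangle4 x x' y' y, dist_comm y y']

theorem tendsto_ofReal_one_sub_rpow_mul {ℓ : ℝ} (s : ℝ) {u : ℝ≥0∞} (hu : u ≠ ∞) :
    Tendsto (fun ε : ℝ => ENNReal.ofReal ((1 - 2 * ε / ℓ) ^ (-s)) * u) (𝓝 0) (𝓝 u) := by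
  have continuousAt : ContinuousAt (fun ε : ℝ => (1 - 2 * ε / ℓ) ^ (-s)) 0 :=
    ContinuousAt.rpow_const (by fun_prop) (Or.inl (by simp))
  have := ENNReal.Tendsto.mul_const (b := u)
    ((ENNReal.continuous_ofReal.tendsto _).comp continuousAt.tendsto) (Or.inr hu)
  simpa using this

theorem Curve.lowerSemicontinuous_minEnergy {s ℓ : ℝ} (hs : 0 ≤ s) (hℓ : 0 < ℓ) :
    LowerSemicontinuous fun C : Curve Λ => minEnergy s ℓ C.trace := by
  intro C u hu
  have eventually_mul_lt : ∀ᶠ ε : ℝ in 𝓝[>] 0,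
      ENNReal.ofReal ((1 - 2 * ε / ℓ) ^ (-s)) * u < minEnergy s ℓ C.trace :=
    nhdsWithin_le_nhds ((tendsto_ofReal_one_sub_rpow_mul s hu.ne_top).eventually_lt_const hu)
  obtain ⟨ε, mul_lt, hε, hεℓ⟩ :=
    (eventually_mul_lt.and (Ioo_mem_nhdsGT (half_pos hℓ))).exists
  filter_upwards [Metric.ball_mem_nhds C hε] with C' hC'
  by_contra! minEnergy_le
  exact mul_lt.not_ge <| (minEnergy_le_of_subset_thickening hs hℓ hε.le (by linarith)
    C.isCompact_trace.measurableSet C.trace_nonempty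
    (trace_subset_thickening (Metric.mem_ball.1 hC'))).trans (mul_le_mul_right minEnergy_le _)

end MinEnergy

/-! ### Energy and Hausdorff dimension -/

section Dimension

theorem exists_pos_add_rpow_le_rpow_add {a ε : ℝ≥0∞} (ha : a ≠ ∞) {s : ℝ} (hs : 0 ≤ s)
    (hε : ε ≠ 0) : ∃ ρ : ℝ≥0, 0 < ρ ∧ (a + 2 * ρ) ^ s ≤ a ^ s + ε := by
  have continuous_rpow : Continuous fun ρ : ℝ≥0 => (a + 2 * ρ) ^ s :=
    ENNReal.continuous_rpow_const.comp (continuous_const.add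
      (ENNReal.continuous_const_mul ENNReal.ofNat_ne_top |>.comp ENNReal.continuous_coe))
  have lt_add : (a + 2 * (0 : ℝ≥0)) ^ s < a ^ s + ε := by
    rw [ENNReal.coe_zero, mul_zero, add_zero]
    exact ENNReal.lt_add_right (ENNReal.rpow_ne_top_of_nonneg hs ha) hε
  have eventually_lt : ∀ᶠ ρ : ℝ≥0 in 𝓝[>] 0, (a + 2 * ρ) ^ s < a ^ s + ε :=
    nhdsWithin_le_nhds (continuous_rpow.continuousAt.eventually_lt_const lt_add)
  obtain ⟨ρ, lt, hρ⟩ := (eventually_lt.and self_mem_nhdsWithin).exists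
  exact ⟨ρ, hρ, lt.le⟩

theorem exists_open_cover_of_hausdorffMeasure_eq_zero {X : Type*} [EMetricSpace X]
    [MeasurableSpace X] [BorelSpace X] {s : ℝ} (hs : 0 < s) {K : Set X} (h : μH[s] K = 0)
    {η : ℝ≥0∞} (hη : η ≠ 0) :
    ∃ (U : ℕ → Set X) (D : ℕ → ℝ≥0∞), (∀ n, IsOpen (U n)) ∧ K ⊆ ⋃ n, U n ∧
      (∀ n, 0 < D n) ∧ (∀ n, Metric.ediam (U n) ≤ D n) ∧ ∑' n, D n ^ s ≤ η := by
  have half_ne_zero : η / 2 ≠ 0 := (ENNReal.half_pos hη).ne'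
  rw [Measure.hausdorffMeasure_apply] at h
  have inf_eq_zero := ENNReal.iSup_eq_zero.1 (ENNReal.iSup_eq_zero.1 h 1) one_pos
  have inf_lt := inf_eq_zero.trans_lt (pos_iff_ne_zero.2 half_ne_zero)
  simp only [iInf_lt_iff] at inf_lt
  obtain ⟨t, subset_t, ediam_le_one, tsum_lt⟩ := inf_lt
  obtain ⟨ε, ε_pos, tsum_ε_lt⟩ := ENNReal.exists_pos_sum_of_countable' half_ne_zero ℕ
  choose ρ ρ_pos rpow_le using fun n => exists_pos_add_rpow_le_rpow_add
    ((ediam_le_one n).trans_lt ENNReal.one_lt_top).ne hs.le (ε_pos n).ne'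
  refine ⟨fun n => Metric.thickening (ρ n) (t n), fun n => Metric.ediam (t n) + 2 * ρ n,
    fun n => Metric.isOpen_thickening,
    subset_t.trans (Set.iUnion_mono fun n => Metric.self_subset_thickening (ρ_pos n) _),
    fun n => ?_, fun n => Metric.ediam_thickening_le (ρ n), ?_⟩
  · exact lt_of_lt_of_le (ENNReal.mul_pos two_ne_zero (ENNReal.coe_pos.2 (ρ_pos n)).ne')
      le_add_self
  · have rpow_le_iSup (n : ℕ) :
        Metric.ediam (t n) ^ s ≤ ⨆ _ : (t n).Nonempty, Metric.ediam (t n) ^ s := by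
      rcases (t n).eq_empty_or_nonempty with ht | ht
      · rw [ht, Metric.ediam_empty, ENNReal.zero_rpow_of_pos hs]
        exact zero_le
      · exact le_iSup_of_le ht le_rfl
    calc ∑' n, (Metric.ediam (t n) + 2 * ρ n) ^ s
      _ ≤ ∑' n, ((⨆ _ : (t n).Nonempty, Metric.ediam (t n) ^ s) + ε n) :=
        ENNReal.tsum_le_tsum fun n =>
          (rpow_le n).trans (add_le_add_left (rpow_le_iSup n) (ε n))
      _ ≤ η / 2 + η / 2 := by
        rw [ENNReal.tsum_add]
        exact add_le_add tsum_lt.le tsum_ε_lt.le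
      _ = η := ENNReal.add_halves η

variable {d : ℕ}

/-- The Riesz potential of `ν` at `x`, with the kernel of exponent `s` cut off at distance `ℓ`;
the energy of `ν` is its integral. -/
def potential (s ℓ : ℝ) (ν : Measure (E d)) (x : E d) : ℝ≥0∞ :=
  ∫⁻ y, (max (edist x y) (ENNReal.ofReal ℓ)) ^ (-s) ∂ν

theorem measure_le_mul_potential {s ℓ : ℝ} (hs : 0 ≤ s) (ν : Measure (E d)) {U : Set (E d)}
    {D : ℝ≥0∞} (hD : 0 < D) (hD' : D ≠ ∞) (ediam_le : Metric.ediam U ≤ D)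
    (hℓ : ENNReal.ofReal ℓ ≤ D) {x : E d} (hx : x ∈ U) : ν U ≤ D ^ s * potential s ℓ ν x := by
  rw [← ENNReal.inv_mul_le_iff (ENNReal.rpow_pos hD hD').ne'
    (ENNReal.rpow_ne_top_of_nonneg hs hD'), ← ENNReal.rpow_neg]
  have measurable_kernel : Measurable fun y => (max (edist x y) (ENNReal.ofReal ℓ)) ^ (-s) :=
    ((measurable_const.edist measurable_id).max measurable_const).pow_const (-s)
  calc D ^ (-s) * ν U
    _ = ∫⁻ _ in U, D ^ (-s) ∂ν := (setLIntegral_const U _).symm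
    _ ≤ ∫⁻ y in U, (max (edist x y) (ENNReal.ofReal ℓ)) ^ (-s) ∂ν :=
      setLIntegral_mono measurable_kernel fun y hy =>
        rpow_neg_le_rpow_neg hs
          (max_le ((Metric.edist_le_ediam_of_mem hx hy).trans ediam_le) hℓ)
    _ ≤ potential s ℓ ν x := setLIntegral_le_lintegral U _

theorem one_le_mul_sum_add_energy_div {s ℓ : ℝ} (hs : 0 ≤ s) {ν : ProbabilityMeasure (E d)}
    {K : Set (E d)} (hν : (ν : Measure (E d)) Kᶜ = 0) {ι : Type*} {J : Finset ι}
    {U : ι → Set (E d)} {D : ι → ℝ≥0∞} (subset_U : K ⊆ ⋃ n ∈ J, U n)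
    (hD : ∀ n ∈ J, 0 < D n) (hD' : ∀ n ∈ J, D n ≠ ∞) (ediam_le : ∀ n ∈ J, Metric.ediam (U n) ≤ D n)
    (hℓ : ∀ n ∈ J, ENNReal.ofReal ℓ ≤ D n) {v : ℝ≥0∞} (hv : v ≠ 0) (hv' : v ≠ ∞) :
    1 ≤ v * ∑ n ∈ J, D n ^ s + energy s ℓ ν / v := by
  set m : Measure (E d) := (ν : Measure (E d))
  have measurable_potential : Measurable (potential s ℓ m) :=
    (measurable_energyKernel s ℓ).lintegral_prod_right'
  have univ_subset : Set.univ ⊆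
      (⋃ n ∈ J, U n ∩ {x | potential s ℓ m x < v}) ∪ {x | v ≤ potential s ℓ m x} ∪ Kᶜ := by
    intro x _
    by_cases hx : x ∈ K
    · obtain ⟨n, hn, hxn⟩ := Set.mem_iUnion₂.1 (subset_U hx)
      exact Or.inl ((lt_or_ge (potential s ℓ m x) v).imp_left
        fun lt => Set.mem_iUnion₂.2 ⟨n, hn, hxn, lt⟩)
    · exact Or.inr hx
  have measure_low_le : ∀ n ∈ J, m (U n ∩ {x | potential s ℓ m x < v}) ≤ v * D n ^ s := by
    intro n hn
    rcases (U n ∩ {x | potential s ℓ m x < v}).eq_empty_or_nonempty with hU | ⟨x, hxU, lt⟩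
    · rw [hU, measure_empty]
      exact zero_le
    · calc m (U n ∩ {x | potential s ℓ m x < v})
        _ ≤ m (U n) := measure_mono Set.inter_subset_left
        _ ≤ D n ^ s * potential s ℓ m x :=
          measure_le_mul_potential hs m (hD n hn) (hD' n hn) (ediam_le n hn) (hℓ n hn) hxU
        _ ≤ v * D n ^ s := by rw [mul_comm v]; exact mul_le_mul_right (le_of_lt lt) _
  calc (1 : ℝ≥0∞) = m Set.univ := measure_univ.symm
    _ ≤ m (⋃ n ∈ J, U n ∩ {x | potential s ℓ m x < v}) + m {x | v ≤ potential s ℓ m x} + m Kᶜ :=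
      (measure_mono univ_subset).trans <| (measure_union_le _ _).trans
        (add_le_add_left (measure_union_le _ _) _)
    _ ≤ v * ∑ n ∈ J, D n ^ s + energy s ℓ ν / v := by
      rw [hν, add_zero, Finset.mul_sum]
      exact add_le_add ((measure_biUnion_finset_le _ _).trans (Finset.sum_le_sum measure_low_le))
        (meas_ge_le_lintegral_div measurable_potential.aemeasurable hv hv')

theorem exists_pos_forall_ofReal_le {ι : Type*} (J : Finset ι) {D : ι → ℝ≥0∞}
    (hD : ∀ n ∈ J, 0 < D n) : ∃ ℓ : ℝ, 0 < ℓ ∧ ∀ n ∈ J, ENNReal.ofReal ℓ ≤ D n := by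
  have tendsto_zero : Tendsto ENNReal.ofReal (𝓝[>] 0) (𝓝 0) :=
    (ENNReal.ofReal_zero ▸ ENNReal.continuous_ofReal.tendsto 0).mono_left nhdsWithin_le_nhds
  have eventually_le : ∀ᶠ ℓ : ℝ in 𝓝[>] 0, ∀ n ∈ J, ENNReal.ofReal ℓ ≤ D n :=
    (Filter.eventually_all_finset J).2 fun n hn =>
      (tendsto_zero.eventually_lt_const (hD n hn)).mono fun _ => le_of_lt
  obtain ⟨ℓ, le, hℓ⟩ := (eventually_le.and self_mem_nhdsWithin).exists
  exact ⟨ℓ, hℓ, le⟩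

theorem hausdorffMeasure_ne_zero_of_minEnergy_le {s : ℝ} (hs : 0 < s) {K : Set (E d)}
    (hK : IsCompact K) {u : ℝ≥0} (h : ∀ ℓ : ℝ, 0 < ℓ → minEnergy s ℓ K ≤ u) : μH[s] K ≠ 0 := by
  intro hausdorff_eq_zero
  set w : ℝ≥0 := u + 1
  have w_ne_zero : w ≠ 0 := (add_pos_of_nonneg_of_pos (zero_le (a := u)) one_pos).ne'
  obtain ⟨U, D, isOpen_U, subset_U, D_pos, ediam_le, tsum_le⟩ :=
    exists_open_cover_of_hausdorffMeasure_eq_zero hs hausdorff_eq_zero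
      (η := ((8 * w)⁻¹ : ℝ≥0)) (by simpa using w_ne_zero)
  have D_ne_top (n : ℕ) : D n ≠ ∞ := fun hn => by
    have := (ENNReal.le_tsum n).trans tsum_le
    rw [hn, ENNReal.top_rpow_of_pos hs] at this
    exact ENNReal.coe_ne_top (top_le_iff.1 this)
  obtain ⟨J, subset_biUnion⟩ := hK.elim_finite_subcover U isOpen_U subset_U
  obtain ⟨ℓ, ℓ_pos, hℓ⟩ := exists_pos_forall_ofReal_le J fun n _ => D_pos n
  have minEnergy_lt : minEnergy s ℓ K < w :=
    (h ℓ ℓ_pos).trans_lt (ENNReal.coe_lt_coe.2 (lt_add_one u))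
  simp only [minEnergy, iInf_lt_iff] at minEnergy_lt
  obtain ⟨ν, hν, energy_lt⟩ := minEnergy_lt
  have one_le : (1 : ℝ≥0∞) ≤ (2 * w : ℝ≥0) * ((8 * w)⁻¹ : ℝ≥0) + w / (2 * w : ℝ≥0) := calc
    _ ≤ (2 * w : ℝ≥0) * ∑ n ∈ J, D n ^ s + energy s ℓ ν / (2 * w : ℝ≥0) :=
      one_le_mul_sum_add_energy_div hs.le hν subset_biUnion (fun n _ => D_pos n)
        (fun n _ => D_ne_top n) (fun n _ => ediam_le n) hℓ (by simpa using w_ne_zero)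
        ENNReal.coe_ne_top
    _ ≤ _ := add_le_add (mul_le_mul_right ((ENNReal.sum_le_tsum J).trans tsum_le) _)
      (ENNReal.div_le_div_right energy_lt.le _)
  rw [← ENNReal.coe_mul, ← ENNReal.coe_div (by simpa using w_ne_zero), ← ENNReal.coe_add,
    ENNReal.one_le_coe_iff] at one_le
  have three_quarters : 2 * w * (8 * w)⁻¹ + w / (2 * w) = 3 / 4 := by
    field_simp
    norm_num
  exact absurd (three_quarters ▸ one_le) (by norm_num)

theorem ofReal_le_dimH_of_minEnergy_le {s : ℝ} (hs : 0 < s) {K : Set (E d)} (hK : IsCompact K)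
    {u : ℝ≥0} (h : ∀ ℓ : ℝ, 0 < ℓ → minEnergy s ℓ K ≤ u) : ENNReal.ofReal s ≤ dimH K :=
  le_dimH_of_hausdorffMeasure_ne_zero <| by
    rw [Real.coe_toNNReal s hs.le]
    exact hausdorffMeasure_ne_zero_of_minEnergy_le hs hK h

theorem lipschitzOnWith_of_hasConstantSpeedOnWith {X : Type*} [PseudoEMetricSpace X] {f : ℝ → X}
    {s : Set ℝ} {l : ℝ≥0} (h : HasConstantSpeedOnWith f s l) : LipschitzOnWith l f s := by
  intro x hx y hy
  wlog hxy : x ≤ y generalizing x y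
  · rw [edist_comm (f x), edist_comm x]
    exact this hy hx (le_of_not_ge hxy)
  calc edist (f x) (f y)
    _ ≤ eVariationOn f (s ∩ Set.Icc x y) :=
      eVariationOn.edist_le f ⟨hx, le_rfl, hxy⟩ ⟨hy, hxy, le_rfl⟩
    _ = l * edist x y := by
      rw [h hx hy, ENNReal.ofReal_mul l.coe_nonneg, ENNReal.ofReal_coe_nnreal, edist_comm,
        edist_dist, Real.dist_eq, abs_of_nonneg (sub_nonneg.2 hxy)]

theorem dimH_image_le_one_of_locallyBoundedVariationOn {α X : Type*} [LinearOrder α]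
    [EMetricSpace X] {f : α → X} {s : Set α} (hf : LocallyBoundedVariationOn f s) :
    dimH (f '' s) ≤ 1 := by
  rcases s.eq_empty_or_nonempty with rfl | ⟨a, ha⟩
  · simp only [Set.image_empty, dimH_empty, zero_le]
  have image_eq : f '' s = naturalParameterization f s a '' (variationOnFromTo f s a '' s) := by
    rw [Set.image_image]
    exact Set.image_congr fun b hb =>
      (edist_eq_zero.1 (edist_naturalParameterization_eq_zero hf ha hb)).symm
  rw [image_eq]
  calc _ ≤ dimH (variationOnFromTo f s a '' s) := (lipschitzOnWith_of_hasConstantSpeedOnWith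
        (has_unit_speed_naturalParameterization f hf ha)).dimH_image_le
    _ ≤ dimH (Set.univ : Set ℝ) := dimH_mono (Set.subset_univ _)
    _ = 1 := Real.dimH_univ

theorem Curve.dimH_trace_le_one_of_isRectifiable {Λ : Set (E d)} {C : Curve Λ}
    (h : C.IsRectifiable) : dimH C.trace ≤ 1 := by
  obtain ⟨f, rfl, variation_ne_top⟩ := h
  have hf : BoundedVariationOn f.eval Set.univ := variation_ne_top
  rw [trace_mk, ← Set.image_univ]
  exact dimH_image_le_one_of_locallyBoundedVariationOn hf.locallyBoundedVariationOn

end Dimension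

/-! ### Scaling limits -/

section Limit

theorem measure_le_of_tendsto_of_isOpen {Ω ι : Type*} [MeasurableSpace Ω] [TopologicalSpace Ω]
    [OpensMeasurableSpace Ω] [HasOuterApproxClosed Ω] {L : Filter ι} [L.NeBot]
    {μ : ι → ProbabilityMeasure Ω} {ν : ProbabilityMeasure Ω} (hν : Tendsto μ L (𝓝 ν)) {U : Set Ω}
    (hU : IsOpen U) {ε : ℝ≥0∞} (h : ∀ᶠ n in L, (μ n : Measure Ω) U ≤ ε) :
    (ν : Measure Ω) U ≤ ε :=
  (ProbabilityMeasure.le_liminf_measure_open_of_tendsto hν hU).trans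
    (Filter.liminf_le_of_frequently_le' h.frequently)

variable {d : ℕ} {Λ : Set (E d)} {s r : ℝ}

/-- Some curve of diameter larger than `r` has capacity smaller than `1 / u` at cutoff `ℓ`. -/
def lowCapacityEvent (Λ : Set (E d)) (s r ℓ : ℝ) (u : ℝ≥0) : Set (Config Λ) :=
  {F | ∃ C ∈ F, r < C.diam ∧ (u : ℝ≥0∞) < minEnergy s ℓ C.trace}

theorem lowCapacityEvent_anti (hs : 0 ≤ s) {ℓ ℓ' : ℝ} (h : ℓ ≤ ℓ') (u : ℝ≥0) :
    lowCapacityEvent Λ s r ℓ' u ⊆ lowCapacityEvent Λ s r ℓ u :=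
  fun _ ⟨C, hC, hr, hu⟩ => ⟨C, hC, hr, hu.trans_le (minEnergy_anti hs h _)⟩

theorem isOpen_lowCapacityEvent {ℓ : ℝ} (hs : 0 ≤ s) (hℓ : 0 < ℓ) (u : ℝ≥0) :
    IsOpen (lowCapacityEvent Λ s r ℓ u) :=
  Closeds.isOpen_inter_nonempty_of_isOpen <|
    (isOpen_Ioi.preimage Curve.lipschitzWith_diam.continuous).inter
      ((Curve.lowerSemicontinuous_minEnergy hs hℓ).isOpen_preimage u)

theorem lowCapacityEvent_subset_le_inv_minCapacity (δ : ℝ) (u : ℝ≥0) :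
    lowCapacityEvent Λ s r δ u ⊆ {F | (u : ℝ≥0∞) ≤ (minCapacity s r δ F)⁻¹} := by
  rintro F ⟨C, hC, hr, hu⟩
  calc (u : ℝ≥0∞) ≤ (capacity s δ C.trace)⁻¹ := by rw [inv_capacity]; exact hu.le
    _ ≤ (minCapacity s r δ F)⁻¹ := ENNReal.inv_le_inv.2
      (iInf_le_of_le C (iInf_le_of_le hC (iInf_le_of_le hr.le le_rfl)))

variable {δmax : ℝ} {μ : Set.Ioc 0 δmax → ProbabilityMeasure (Config Λ)}
  {δ : ℕ → Set.Ioc 0 δmax} {ν : ProbabilityMeasure (Config Λ)}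

theorem measure_lowCapacityEvent_le (hs : 0 ≤ s)
    (hδ : Tendsto (fun n => (δ n : ℝ)) atTop (𝓝 0)) (hν : Tendsto (fun n => μ (δ n)) atTop (𝓝 ν))
    {ε u : ℝ≥0} (h : ∀ δ : Set.Ioc 0 δmax,
      (μ δ : Measure (Config Λ)).real {F | (u : ℝ≥0∞) ≤ (minCapacity s r δ F)⁻¹} ≤ ε)
    {ℓ : ℝ} (hℓ : 0 < ℓ) : (ν : Measure (Config Λ)) (lowCapacityEvent Λ s r ℓ u) ≤ ε := by
  refine measure_le_of_tendsto_of_isOpen hν (isOpen_lowCapacityEvent hs hℓ u) ?_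
  filter_upwards [hδ.eventually_lt_const hℓ] with n hn
  calc (μ (δ n) : Measure (Config Λ)) (lowCapacityEvent Λ s r ℓ u)
    _ ≤ (μ (δ n) : Measure (Config Λ)) {F | (u : ℝ≥0∞) ≤ (minCapacity s r (δ n) F)⁻¹} :=
      measure_mono ((lowCapacityEvent_anti hs hn.le u).trans
        (lowCapacityEvent_subset_le_inv_minCapacity _ u))
    _ ≤ ENNReal.ofReal ε := (ENNReal.le_ofReal_iff_toReal_le (measure_ne_top _ _) ε.2).2 (h (δ n))
    _ = ε := ENNReal.ofReal_coe_nnreal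

theorem ae_exists_minEnergy_le (hs : 0 ≤ s)
    (h : StochasticallyBoundedAwayFromZero μ fun δ F => minCapacity s r (δ : ℝ) F)
    (hδ : Tendsto (fun n => (δ n : ℝ)) atTop (𝓝 0))
    (hν : Tendsto (fun n => μ (δ n)) atTop (𝓝 ν)) :
    ∀ᵐ F ∂(ν : Measure (Config Λ)), ∀ C ∈ F, r < C.diam →
      ∃ u : ℝ≥0, ∀ ℓ : ℝ, 0 < ℓ → minEnergy s ℓ C.trace ≤ u := by
  rw [ae_iff]
  refine le_antisymm (ENNReal.le_of_forall_pos_le_add fun ε hε _ => ?_) zero_le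
  rw [zero_add]
  obtain ⟨u, hu⟩ := h ε hε
  have monotone_event : Monotone fun j : ℕ => lowCapacityEvent Λ s r (1 / ((j : ℝ) + 1)) u :=
    fun i j hij => lowCapacityEvent_anti hs (Nat.one_div_le_one_div hij) u
  calc (ν : Measure (Config Λ)) _
    _ ≤ (ν : Measure (Config Λ)) (⋃ j : ℕ, lowCapacityEvent Λ s r (1 / ((j : ℝ) + 1)) u) := by
      refine measure_mono fun F hF => ?_
      simp only [Set.mem_ofPred_eq, not_forall, not_exists, not_le] at hF
      obtain ⟨C, hC, hr, unbounded⟩ := hF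
      obtain ⟨ℓ, hℓ, hlt⟩ := unbounded u
      obtain ⟨j, hj⟩ := exists_nat_one_div_lt hℓ
      exact Set.mem_iUnion.2 ⟨j, lowCapacityEvent_anti hs hj.le u ⟨C, hC, hr, hlt⟩⟩
    _ = ⨆ j : ℕ, (ν : Measure (Config Λ)) (lowCapacityEvent Λ s r (1 / ((j : ℝ) + 1)) u) :=
      monotone_event.measure_iUnion
    _ ≤ ε := iSup_le fun _ => measure_lowCapacityEvent_le hs hδ hν hu Nat.one_div_pos_of_nat

theorem ofReal_le_of_forall_rat_lt {D : ℝ} {x : ℝ≥0∞}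
    (h : ∀ s : ℚ, 0 < (s : ℝ) → (s : ℝ) < D → ENNReal.ofReal s ≤ x) : ENNReal.ofReal D ≤ x := by
  by_contra! lt
  obtain ⟨s, -, lt_s, s_lt⟩ := ENNReal.lt_iff_exists_rat_btwn.1 lt
  have s_pos : 0 < (s : ℝ) := Real.toNNReal_pos.1 (ENNReal.coe_pos.1 (pos_of_gt lt_s))
  exact (h s s_pos ((ENNReal.ofReal_lt_ofReal_iff'.1 s_lt).1)).not_gt lt_s

theorem ae_ofReal_le_dimH_of_stochasticallyBoundedAwayFromZero {D : ℝ}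
    (h : ∀ r s : ℝ, 0 < r → 0 < s → s < D →
      StochasticallyBoundedAwayFromZero μ fun δ F => minCapacity s r (δ : ℝ) F)
    (hδ : Tendsto (fun n => (δ n : ℝ)) atTop (𝓝 0))
    (hν : Tendsto (fun n => μ (δ n)) atTop (𝓝 ν)) :
    ∀ᵐ F ∂(ν : Measure (Config Λ)), ∀ C ∈ F, 0 < C.diam → ENNReal.ofReal D ≤ dimH C.trace := by
  have minEnergy_bounded : ∀ᵐ F ∂(ν : Measure (Config Λ)), ∀ (j : ℕ) (s : ℚ), 0 < (s : ℝ) →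
      (s : ℝ) < D → ∀ C ∈ F, 1 / ((j : ℝ) + 1) < C.diam →
        ∃ u : ℝ≥0, ∀ ℓ : ℝ, 0 < ℓ → minEnergy s ℓ C.trace ≤ u := by
    simp only [ae_all_iff]
    exact fun j s hs hsD => ae_exists_minEnergy_le hs.le
      (h _ s Nat.one_div_pos_of_nat hs hsD) hδ hν
  filter_upwards [minEnergy_bounded] with F hF C hC hdiam
  obtain ⟨j, hj⟩ := exists_nat_one_div_lt hdiam
  refine ofReal_le_of_forall_rat_lt fun s hs hsD => ?_
  obtain ⟨u, hu⟩ := hF j s hs hsD C hC hj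
  exact ofReal_le_dimH_of_minEnergy_le hs C.isCompact_trace hu

end Limit

end

end RandomCurves

theorem mainTheorem3_general {d : ℕ} (Λ : Set (E d)) (hΛ : Bornology.IsBounded Λ) (δmax : ℝ)
    (μ : Set.Ioc 0 δmax → ProbabilityMeasure (Config Λ)) (hμ : HypothesisH2 μ) :
    ∃ dmin : ℝ, 1 < dmin ∧
      (∀ r s : ℝ, 0 < r → 0 < s → s < dmin →
        StochasticallyBoundedAwayFromZero μ (fun δ F => minCapacity s r (δ : ℝ) F)) ∧
      (∀ (δ : ℕ → Set.Ioc 0 δmax) (ν : ProbabilityMeasure (Config Λ)),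
        Tendsto (fun n => (δ n : ℝ)) atTop (𝓝 0) →
        Tendsto (fun n => μ (δ n)) atTop (𝓝 ν) →
        ∀ᵐ F ∂(ν : Measure (Config Λ)), ∀ C ∈ F, 0 < C.diam →
          ENNReal.ofReal dmin ≤ dimH C.trace ∧ ¬ C.IsRectifiable) := by
  obtain ⟨q, A, hq, hA, rare⟩ := hμ.exists_measureReal_straightEvent_le hΛ
  have capacity_bound : ∀ r s : ℝ, 0 < r → 0 < s → s < roughDim q →
      StochasticallyBoundedAwayFromZero μ fun δ F => minCapacity s r (δ : ℝ) F := by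
    intro r s hr hs hsd
    obtain ⟨c, hc, rare_r⟩ := rare r hr
    exact stochasticallyBoundedAwayFromZero_minCapacity hq hr hA hc rare_r hs.le hsd
  refine ⟨roughDim q, one_lt_roughDim hq, capacity_bound, fun δ ν hδ hν => ?_⟩
  filter_upwards [ae_ofReal_le_dimH_of_stochasticallyBoundedAwayFromZero capacity_bound hδ hν]
    with F dim_ge C hC hdiam
  refine ⟨dim_ge C hC hdiam, fun rectifiable => (one_lt_roughDim hq).not_ge ?_⟩
  exact ENNReal.ofReal_le_one.1
    ((dim_ge C hC hdiam).trans (Curve.dimH_trace_le_one_of_isRectifiable rectifiable))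

theorem mainTheorem3 {d : ℕ} (Λ : Set (E d)) (hΛ : IsCompact Λ) (δmax : ℝ)
    (μ : Set.Ioc 0 δmax → ProbabilityMeasure (Config Λ)) (hμ : HypothesisH2 μ) :
    ∃ dmin : ℝ, 1 < dmin ∧
      (∀ r s : ℝ, 0 < r → 0 < s → s < dmin →
        StochasticallyBoundedAwayFromZero μ (fun δ F => minCapacity s r (δ : ℝ) F)) ∧
      (∀ (δ : ℕ → Set.Ioc 0 δmax) (ν : ProbabilityMeasure (Config Λ)),
        Tendsto (fun n => (δ n : ℝ)) atTop (𝓝 0) →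
        Tendsto (fun n => μ (δ n)) atTop (𝓝 ν) →
        ∀ᵐ F ∂(ν : Measure (Config Λ)), ∀ C ∈ F, 0 < C.diam →
          ENNReal.ofReal dmin ≤ dimH C.trace ∧ ¬ C.IsRectifiable) :=
  mainTheorem3_general Λ hΛ.isBounded δmax μ hμ
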